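/- **Setting.** Let $\mathcal H$ be an infinite-dimensional separable real Hilbert space (for instance $L^2[0,1]$) and write $a\otimes b$ for the operator $\zeta\mapsto\langle a,\zeta\rangle b$. Let $y_t,x_t,z_t,u_t,v_t$ ($t\ge 1$) be random elements of $\mathcal H$ on a probability space, with $y_t,x_t,z_t$ of mean zero, and let $\mathcal A,\mathcal B$ be bounded linear operators on $\mathcal H$. Put $\mathcal C_{zz}=\mathbb E[z_t\otimes z_t]$, $\mathcal C_{xz}=\mathbb E[x_t\otimes z_t]$, $\mathcal C_{uz}=\mathbb E[u_t\otimes z_t]$, $\mathcal C_{uu}=\mathbb E[u_t\otimes u_t]$, $\widehat{\mathcal C}_{ab}=T^{-1}\sum_{t=1}^T a_t\otimes b_t$, and $\mathcal Q=\mathcal C_{xz}^*\mathcal C_{zz}^{-1}\mathcal C_{xz}=\sum_{j}\mu_j^{-1}(\mathcal C_{xz}^*g_j)\otimes(\mathcal C_{xz}^*g_j)$, where $\mathcal C_{zz}=\sum_j\mu_j\,g_j\otimes g_j$ and $\mathcal Q=\sum_j\nu_j\,h_j\otimes h_j$ are the spectral decompositions with eigenvalues in nonincreasing order. **Assumption 3.**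 (a) $y_t=\mathcal Ax_t+u_t$ with $\mathbb E[x_t\otimes u_t]\ne0$ and $\mathbb E[u_t]=0$; $x_t=\mathcal Bz_t+v_t$ with $\mathbb E[z_t\otimes v_t]=0$ and $\mathbb E[v_t]=0$; $(x_t,z_t)_{t\ge1}$ is strictly stationary and geometrically strongly mixing, with $\mathbb E\|x_t\|^2<\infty$, $\mathbb E\|z_t\|^2<\infty$; with $\mathfrak F_{t-1}=\sigma(z_1,\dots,z_t,u_1,\dots,u_{t-1})$, $\mathbb E\|u_t\|^2<\infty$, $\mathbb E[u_t\mid\mathfrak F_{t-1}]=0$, $\mathbb E[u_t\otimes u_t\mid\mathfrak F_{t-1}]=\mathcal C_{uu}$, and, for some $\delta>0$, $\mathbb E[\|u_t\|^{2+\delta}\mid\mathfrak F_{t-1}]<\infty$ a.s. for every $t$. (b) $\ker\mathcal Q=\{0\}$ and $\mathcal A$ is Hilbert–Schmidt. (c) $\mu_1>\mu_2>\dots>0$ and $\nu_1>\nu_2>\dots>0$. (d) $\|\widehat{\mathcal C}_{xz}-\mathcal C_{xz}\|_{HS}$, $\|\widehat{\mathcal C}_{zz}-\mathcal C_{zz}\|_{HS}$,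 $\|\widehat{\mathcal C}_{uz}-\mathcal C_{uz}\|_{HS}$ and $\|\widehat{\mathcal C}_{vz}\|_{HS}$ are $O_p(T^{-1/2})$, and $\|\widehat{\mathcal C}_{uu}-\mathcal C_{uu}\|_{HS}=o_p(1)$. **Estimator.** Let $\alpha_1=\alpha_1(T)>0$ and $\alpha_2=\alpha_2(T)>0$ be deterministic. For a compact nonnegative self-adjoint operator $\mathcal S=\sum_j s_j\,e_j\otimes e_j$ with $s_1\ge s_2\ge\dots\ge0$, and $K$ not exceeding the number of positive $s_j$, let $\mathcal S_K^{-1}=\sum_{j\le K}s_j^{-1}e_j\otimes e_j$. Let $\hat\mu_j$ be the ordered eigenvalues of $\widehat{\mathcal C}_{zz}$, $K_1=\#\{j:\hat\mu_j^2>\alpha_1\}$, $\widehat{\mathcal P}=\widehat{\mathcal C}_{yz}^*(\widehat{\mathcal C}_{zz})_{K_1}^{-1}\widehat{\mathcal C}_{xz}$, $\widehat{\mathcal Q}=\widehat{\mathcal C}_{xz}^*(\widehat{\mathcal C}_{zz})_{K_1}^{-1}\widehat{\mathcal C}_{xz}$, let $\hat\nu_j,\hat h_j$ be the ordered eigenvalues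 and orthonormal eigenvectors of $\widehat{\mathcal Q}$, $K_2=\#\{j:\hat\nu_j^2>\alpha_2\}$, $\widetilde{\mathcal A}=\widehat{\mathcal P}\,\widehat{\mathcal Q}_{K_2}^{-1}$ (the functional two-stage least square estimator, F2SLSE) and $\widetilde\Pi_{K_2}=\sum_{j\le K_2}\hat h_j\otimes\hat h_j$. Let $\tau_{1,j}=2\sqrt2\max\{(\mu_{j-1}-\mu_j)^{-1},(\mu_j-\mu_{j+1})^{-1}\}$ and $\tau_{2,j}=2\sqrt2\max\{(\nu_{j-1}-\nu_j)^{-1},(\nu_j-\nu_{j+1})^{-1}\}$, the term with index $j-1=0$ being absent when $j=1$. **Theorem 5.** Suppose that Assumption 3 holds and that, as $T\to\infty$, $\alpha_1\to0$, $\alpha_2\to0$, $\alpha_1\alpha_2^{-1}\to0$, $T^{-1}\alpha_1^{-1}\to0$, $$T^{-1/2}\Big(\sum_{j=1}^{K_1}\mu_j\tau_{1,j}\Big)\Big(\sum_{j=1}^{K_2}\tau_{2,j}\Big)\overset{p}{\to}0\quad\text{and}\quad\Big(\sum_{j=K_1+1}^\infty\mu_j\Big)\Big(\sum_{j=1}^{K_2}\tau_{2,j}\Big)\overset{p}{\to}0.$$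 Then $$\|\widetilde{\mathcal A}-\mathcal A\widetilde\Pi_{K_2}\|_{op}^2=O_p(T^{-1}\alpha_1^{-1/2}\alpha_2^{-1/2})\quad\text{and}\quad\|\mathcal A(\mathcal I-\widetilde\Pi_{K_2})\|_{op}^2=o_p(1).$$ Consequently the F2SLSE is weakly consistent: $\|\widetilde{\mathcal A}-\mathcal A\|_{op}\overset{p}{\to}0$. -/

import Mathlib

open MeasureTheory Filter Topology
open scoped ENNReal

noncomputable section

namespace F2SLS

/-! ### Operators on a real Hilbert space -/

section Operators

variable {H : Type*} [NormedAddCommGroup H] [InnerProductSpace ℝ H]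

/-- The tensor product `a ⊗ b`, that is the rank-one operator `ζ ↦ ⟨a, ζ⟩ b`. -/
def tensor (a b : H) : H →L[ℝ] H := InnerProductSpace.rankOne ℝ b a

/-- `(a, e)` is a system of ordered eigenelements of `S`: the `e j` are orthonormal, the `a j` are
nonnegative and nonincreasing (so eigenvalues are repeated according to multiplicity), and
`S = ∑ j, a j • (e j ⊗ e j)`, the series converging in operator norm.
The index `j : ℕ` stands for the eigenelement of rank `j + 1`. -/
structure IsEigenSystem (S : H →L[ℝ] H) (a : ℕ → ℝ) (e : ℕ → H) : Prop where
  orthonormal : Orthonormal ℝ e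
  nonneg : ∀ j, 0 ≤ a j
  antitone : Antitone a
  tendsto : Tendsto (fun n => ∑ j ∈ Finset.range n, a j • tensor (e j) (e j)) atTop (𝓝 S)

section Existence

variable [CompleteSpace H]

/-- A nonzero compact nonnegative operator attains its norm as an eigenvalue. -/
theorem exists_unit_eigenvector (S : H →L[ℝ] H) (hc : IsCompactOperator S) (hp : S.IsPositive)
    (h0 : S ≠ 0) : ∃ e : H, ‖e‖ = 1 ∧ S e = ‖S‖ • e := by
  have hnt : Nontrivial H := by
    by_contra h
    rw [not_nontrivial_iff_subsingleton] at h
    exact h0 (ContinuousLinearMap.ext fun x => Subsingleton.elim _ _)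
  have hS : ‖S‖ ≠ 0 := norm_ne_zero_iff.mpr h0
  have hspec : algebraMap ℝ ℝ ‖S‖ ∈ spectrum ℝ S := by
    by_contra hcon
    have hres : algebraMap ℝ ℝ ‖S‖ ∈ resolventSet ℝ S := by
      simpa [spectrum] using hcon
    obtain ⟨ε, hε, hb⟩ := S.rayleighQuotient_le_of_norm_mem_resolventSet hres
    have h1 := S.norm_eq_iSup_rayleighQuotient hp.isSymmetric
    have h2 : (⨆ x, |S.rayleighQuotient x|) ≤ ‖S‖ - ε := by
      refine ciSup_le fun x => ?_
      rw [abs_of_nonneg]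
      · exact hb x
      · rw [ContinuousLinearMap.rayleighQuotient]
        have := hp.re_inner_nonneg_left x
        simp only [ContinuousLinearMap.reApplyInnerSelf_apply]
        positivity
    linarith
  have hev : Module.End.HasEigenvalue (S : Module.End ℝ H) ‖S‖ :=
    (hc.hasEigenvalue_iff_mem_spectrum hS).mpr hspec
  obtain ⟨w, hw⟩ := hev.exists_hasEigenvector
  have hw0 : ‖w‖ ≠ 0 := norm_ne_zero_iff.mpr hw.2
  refine ⟨‖w‖⁻¹ • w, ?_, ?_⟩
  · rw [norm_smul, norm_inv, norm_norm, inv_mul_cancel₀ hw0]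
  · have := hw.apply_eq_smul
    rw [map_smul, smul_comm]
    congr 1

/-- One step of the construction: off a finite-dimensional invariant subspace `V`, the norm of a
compact nonnegative operator is attained at a unit eigenvector. -/
theorem exists_next_eigenvector (hinf : ¬ FiniteDimensional ℝ H) (S : H →L[ℝ] H)
    (hc : IsCompactOperator S) (hp : S.IsPositive) (V : Submodule ℝ H)
    (hV : FiniteDimensional ℝ V) (hinv : ∀ x ∈ V, S x ∈ V) :
    ∃ (c : ℝ) (e : H), 0 ≤ c ∧ e ∈ Vᗮ ∧ ‖e‖ = 1 ∧ S e = c • e ∧ ∀ w ∈ Vᗮ, ‖S w‖ ≤ c * ‖w‖ := by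
  have hinv' : ∀ x ∈ Vᗮ, S x ∈ Vᗮ := by
    intro x hx
    rw [Submodule.mem_orthogonal] at hx ⊢
    intro u hu
    have hsym := hp.isSymmetric u x
    simp only [ContinuousLinearMap.coe_coe] at hsym
    rw [← hsym]
    exact hx _ (hinv u hu)
  let S' : Vᗮ →L[ℝ] Vᗮ := S.restrict hinv'
  have hS'c : IsCompactOperator S' := hc.restrict' hinv'
  have hS'p : S'.IsPositive := by
    refine ⟨fun x y => ?_, fun x => ?_⟩
    · exact hp.isSymmetric x y
    · exact hp.2 x
  by_cases h0 : S' = 0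
  · have hne : Vᗮ ≠ ⊥ := by
      intro h
      rw [Submodule.orthogonal_eq_bot_iff] at h
      subst h
      exact hinf (Module.Finite.equiv (Submodule.topEquiv (R := ℝ) (M := H)))
    obtain ⟨w, hw, hw0⟩ := Submodule.exists_mem_ne_zero_of_ne_bot hne
    have hz : ∀ x ∈ Vᗮ, S x = 0 := fun x hx => by
      have := congrArg (fun R : Vᗮ →L[ℝ] Vᗮ => ((R ⟨x, hx⟩ : Vᗮ) : H)) h0
      simpa [S'] using this
    refine ⟨0, ‖w‖⁻¹ • w, le_rfl, Submodule.smul_mem _ _ hw, ?_, ?_, ?_⟩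
    · rw [norm_smul, norm_inv, norm_norm, inv_mul_cancel₀ (norm_ne_zero_iff.mpr hw0)]
    · rw [hz _ (Submodule.smul_mem _ _ hw), zero_smul]
    · intro x hx
      rw [hz x hx]; simp
  · obtain ⟨e, he1, he2⟩ := exists_unit_eigenvector S' hS'c hS'p h0
    refine ⟨‖S'‖, e, norm_nonneg S', e.2, by simpa using he1, ?_, ?_⟩
    · have := congrArg (Subtype.val) he2
      simpa [S'] using this
    · intro w hw
      have := S'.le_opNorm ⟨w, hw⟩
      simpa [S'] using this

/-- Every compact nonnegative (self-adjoint) operator on an infinite-dimensional Hilbert space has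
a system of ordered eigenelements. -/
theorem exists_isEigenSystem (hinf : ¬ FiniteDimensional ℝ H) (S : H →L[ℝ] H)
    (hc : IsCompactOperator S) (hp : S.IsPositive) : ∃ a e, IsEigenSystem S a e := by
  classical
  let St := {V : Submodule ℝ H // FiniteDimensional ℝ V ∧ ∀ x ∈ V, S x ∈ V}
  have step : ∀ V : St, ∃ p : ℝ × H, 0 ≤ p.1 ∧ p.2 ∈ V.1ᗮ ∧ ‖p.2‖ = 1 ∧ S p.2 = p.1 • p.2 ∧
      ∀ w ∈ V.1ᗮ, ‖S w‖ ≤ p.1 * ‖w‖ := fun V => by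
    obtain ⟨c, e, h⟩ := exists_next_eigenvector hinf S hc hp V.1 V.2.1 V.2.2
    exact ⟨(c, e), h⟩
  choose p hp0 hpV hp1 hpS hpB using step
  let nxt : St → St := fun V => ⟨V.1 ⊔ Submodule.span ℝ {(p V).2}, by
    have := V.2.1
    refine ⟨inferInstance, fun x hx => ?_⟩
    obtain ⟨y, hy, z, hz, rfl⟩ := Submodule.mem_sup.mp hx
    obtain ⟨r, rfl⟩ := Submodule.mem_span_singleton.mp hz
    rw [map_add, map_smul, hpS]
    exact Submodule.add_mem_sup (V.2.2 y hy) (Submodule.smul_mem _ _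
      (Submodule.smul_mem _ _ (Submodule.mem_span_singleton_self _)))⟩
  let V : ℕ → St := fun n => Nat.rec (⟨⊥, inferInstance, fun x hx => by
    rw [Submodule.mem_bot] at hx; simp [hx]⟩ : St) (fun _ W => nxt W) n
  have hVs : ∀ n, (V (n + 1)).1 = (V n).1 ⊔ Submodule.span ℝ {(p (V n)).2} := fun n => rfl
  let a : ℕ → ℝ := fun n => (p (V n)).1
  let e : ℕ → H := fun n => (p (V n)).2
  have hVmono : Monotone fun n => (V n).1 :=
    monotone_nat_of_le_succ fun n => by rw [hVs]; exact le_sup_left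
  have hmem : ∀ m n, m < n → e m ∈ (V n).1 := fun m n hmn => by
    refine hVmono (Nat.succ_le_of_lt hmn) ?_
    change e m ∈ (V (m + 1)).1
    rw [hVs]
    exact Submodule.mem_sup_right (Submodule.mem_span_singleton_self _)
  have hspan : ∀ n (w : H), (∀ j < n, inner ℝ (e j) w = 0) → w ∈ (V n).1ᗮ := by
    intro n
    induction n with
    | zero =>
      intro w _
      change w ∈ (⊥ : Submodule ℝ H)ᗮ
      simp
    | succ n ih =>
      intro w hw
      rw [hVs, ← Submodule.inf_orthogonal]
      refine ⟨ih w fun j hj => hw j (Nat.lt_succ_of_lt hj), ?_⟩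
      rw [SetLike.mem_coe, Submodule.mem_orthogonal_singleton_iff_inner_right]
      exact hw n (Nat.lt_succ_self n)
  have hlt : ∀ m n, m < n → inner ℝ (e m) (e n) = 0 := fun m n hmn =>
    (Submodule.mem_orthogonal _ _).mp (hpV (V n)) _ (hmem m n hmn)
  have horth : Orthonormal ℝ e := by
    refine ⟨fun n => hp1 (V n), fun m n hmn => ?_⟩
    rcases lt_or_gt_of_ne hmn with h | h
    · exact hlt m n h
    · rw [real_inner_comm]; exact hlt n m h
  have hSe : ∀ n, S (e n) = a n • e n := fun n => hpS (V n)
  have ha0 : ∀ n, 0 ≤ a n := fun n => hp0 (V n)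
  have hanti : Antitone a := by
    refine antitone_nat_of_succ_le fun n => ?_
    have h1 := hpB (V n) (e (n + 1))
      (Submodule.orthogonal_le (hVmono (Nat.le_succ n)) (hpV (V (n + 1))))
    have h2 : ‖e (n + 1)‖ = 1 := horth.1 (n + 1)
    have h3 : ‖a (n + 1)‖ = a (n + 1) := Real.norm_of_nonneg (ha0 (n + 1))
    rw [hSe (n + 1), norm_smul, h2, mul_one, mul_one, h3] at h1
    exact h1
  have hbound : ∀ n, ‖(∑ j ∈ Finset.range n, a j • tensor (e j) (e j)) - S‖ ≤ a n := by
    intro n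
    rw [norm_sub_rev]
    refine ContinuousLinearMap.opNorm_le_bound _ (ha0 n) fun w => ?_
    set r := ∑ j ∈ Finset.range n, (inner ℝ (e j) w) • e j with hr
    have hq : ∀ j < n, inner ℝ (e j) (w - r) = 0 := by
      intro j hj
      rw [inner_sub_right, hr, inner_sum]
      simp only [inner_smul_right]
      rw [Finset.sum_eq_single j]
      · rw [real_inner_self_eq_norm_sq, horth.1]; simp
      · intro i _ hij
        rw [horth.2 hij.symm, mul_zero]
      · intro h; exact absurd (Finset.mem_range.mpr hj) h
    have happ : (S - ∑ j ∈ Finset.range n, a j • tensor (e j) (e j)) w = S (w - r) := by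
      rw [map_sub, hr, map_sum, sub_apply, sum_apply]
      congr 1
      refine Finset.sum_congr rfl fun j _ => ?_
      rw [map_smul, hSe, smul_apply, tensor,
        InnerProductSpace.rankOne_apply, smul_comm]
    have hnorm : ‖w - r‖ ≤ ‖w‖ := by
      have hz : inner ℝ (w - r) r = 0 := by
        rw [show inner ℝ (w - r) r = ∑ j ∈ Finset.range n, inner ℝ (w - r)
          ((inner ℝ (e j) w) • e j) by rw [← inner_sum]]
        refine Finset.sum_eq_zero fun j hj => ?_
        rw [inner_smul_right, real_inner_comm (e j) (w - r), hq j (Finset.mem_range.mp hj), mul_zero]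
      have := norm_add_sq_eq_norm_sq_add_norm_sq_of_inner_eq_zero _ _ hz
      rw [sub_add_cancel] at this
      nlinarith [norm_nonneg (w - r), norm_nonneg w, mul_self_nonneg ‖r‖]
    rw [happ]
    exact (hpB (V n) _ (hspan n _ hq)).trans (mul_le_mul_of_nonneg_left hnorm (ha0 n))
  have hlim : Tendsto a atTop (𝓝 0) := by
    have hconv := tendsto_atTop_ciInf hanti ⟨0, by rintro _ ⟨n, rfl⟩; exact ha0 n⟩
    set c := ⨅ n, a n with hcdef
    have hcle : ∀ n, c ≤ a n := fun n => ciInf_le ⟨0, by rintro _ ⟨n, rfl⟩; exact ha0 n⟩ n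
    have hc0 : 0 ≤ c := le_ciInf ha0
    rcases hc0.eq_or_lt with h | h
    · rw [← h] at hconv; exact hconv
    exfalso
    obtain ⟨K, hK, hK'⟩ := hc.image_closedBall_subset_compact (𝕜₁ := ℝ) (f := (S : H →ₗ[ℝ] H)) 1
    obtain ⟨y, -, ψ, hψ, hψy⟩ := hK.tendsto_subseq
      (fun n => hK' ⟨e n, by simp [horth.1], rfl⟩)
    have hcs := hψy.cauchySeq
    rw [Metric.cauchySeq_iff'] at hcs
    obtain ⟨N, hN⟩ := hcs c h
    have h1 := hN (N + 1) (Nat.le_succ N)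
    simp only [Function.comp, ContinuousLinearMap.coe_coe, hSe, dist_eq_norm] at h1
    have hne : ψ (N + 1) ≠ ψ N := fun h => by simpa using hψ.injective h
    have hz : inner ℝ (a (ψ (N + 1)) • e (ψ (N + 1))) (a (ψ N) • e (ψ N)) = 0 := by
      rw [inner_smul_left, inner_smul_right, horth.2 hne]; simp
    have h2 := norm_sub_sq_eq_norm_sq_add_norm_sq_real hz
    rw [norm_smul, norm_smul, horth.1, horth.1, Real.norm_of_nonneg (ha0 _),
      Real.norm_of_nonneg (ha0 _), mul_one, mul_one] at h2
    nlinarith [hcle (ψ (N + 1)), hcle (ψ N), ha0 (ψ N),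
      norm_nonneg (a (ψ (N + 1)) • e (ψ (N + 1)) - a (ψ N) • e (ψ N))]
  refine ⟨a, e, horth, ha0, hanti, ?_⟩
  rw [tendsto_iff_norm_sub_tendsto_zero]
  exact squeeze_zero (fun _ => norm_nonneg _) hbound hlim

end Existence

/-- The ordered eigenvalues and corresponding orthonormal eigenvectors of `S`: a system of ordered
eigenelements, which exists for every compact nonnegative operator on an infinite-dimensional
Hilbert space (`exists_isEigenSystem`). -/
def eigenSystem (S : H →L[ℝ] H) : (ℕ → ℝ) × (ℕ → H) :=
  Classical.epsilon fun p => IsEigenSystem S p.1 p.2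

/-- The eigenvalue of `S` of rank `j + 1`, in nonincreasing order. -/
def eigval (S : H →L[ℝ] H) (j : ℕ) : ℝ := (eigenSystem S).1 j

/-- The eigenvector of `S` belonging to its eigenvalue of rank `j + 1`. -/
def eigvec (S : H →L[ℝ] H) (j : ℕ) : H := (eigenSystem S).2 j

theorem isEigenSystem_eigval_eigvec [CompleteSpace H] (hinf : ¬ FiniteDimensional ℝ H)
    (S : H →L[ℝ] H) (hc : IsCompactOperator S) (hp : S.IsPositive) :
    IsEigenSystem S (eigval S) (eigvec S) := by
  obtain ⟨a, e, h⟩ := exists_isEigenSystem hinf S hc hp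
  exact Classical.epsilon_spec (p := fun p : (ℕ → ℝ) × (ℕ → H) => IsEigenSystem S p.1 p.2)
    ⟨(a, e), h⟩

/-- The number of eigenvalues of `S` (with multiplicity) whose square exceeds `α`. -/
def truncLevel (S : H →L[ℝ] H) (α : ℝ) : ℕ := Set.ncard {j : ℕ | α < eigval S j ^ 2}

/-- The regularized inverse of `S` based on its first `K` eigenelements. -/
def regInv (S : H →L[ℝ] H) (K : ℕ) : H →L[ℝ] H :=
  ∑ j ∈ Finset.range K, (eigval S j)⁻¹ • tensor (eigvec S j) (eigvec S j)

/-- The orthogonal projection onto the span of the first `K` eigenvectors of `S`. -/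
def eigProj (S : H →L[ℝ] H) (K : ℕ) : H →L[ℝ] H :=
  ∑ j ∈ Finset.range K, tensor (eigvec S j) (eigvec S j)

/-- The eigenvalue-gap constants `τ_j = 2√2 max {(a_{j-1} - a_j)⁻¹, (a_j - a_{j+1})⁻¹}`, where for
the largest eigenvalue only the gap to the next one is present. -/
def gapConst (a : ℕ → ℝ) : ℕ → ℝ
  | 0 => 2 * √2 * (a 0 - a 1)⁻¹
  | j + 1 => 2 * √2 * max (a j - a (j + 1))⁻¹ (a (j + 1) - a (j + 2))⁻¹

/-- The Hilbert-Schmidt norm, with value `∞` for an operator that is not Hilbert-Schmidt; it is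
computed in some orthonormal basis of the space. -/
def hsNorm [CompleteSpace H] (S : H →L[ℝ] H) : ℝ≥0∞ :=
  (∑' b : (exists_hilbertBasis ℝ H).choose, ‖S (b : H)‖ₑ ^ 2) ^ (1 / 2 : ℝ)

/-- The operator `C* D⁻¹ C` for a compact nonnegative `D = ∑ μ_j g_j ⊗ g_j` with (unbounded) inverse
`D⁻¹ = ∑ μ_j⁻¹ g_j ⊗ g_j`, that is `∑ μ_j⁻¹ (C* g_j) ⊗ (C* g_j)`. -/
def sandwichInv [CompleteSpace H] (D C : H →L[ℝ] H) : H →L[ℝ] H :=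
  ∑' j, (eigval D j)⁻¹ •
    tensor (ContinuousLinearMap.adjoint C (eigvec D j)) (ContinuousLinearMap.adjoint C (eigvec D j))

end Operators

/-! ### Stochastic notions -/

section Stochastic

variable {Ω : Type*} [MeasurableSpace Ω]

/-- `X_T = O_p(r_T)` as `T → ∞`, for nonnegative random quantities `X_T`. -/
def IsBigOp (P : Measure Ω) (X : ℕ → Ω → ℝ≥0∞) (r : ℕ → ℝ) : Prop :=
  ∀ ε : ℝ≥0∞, 0 < ε → ∃ M : ℝ, 0 < M ∧
    ∀ᶠ T in atTop, P {ω | ENNReal.ofReal (M * r T) < X T ω} ≤ ε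

/-- `X_T → 0` in probability as `T → ∞`, i.e. `X_T = o_p(1)`, for nonnegative random quantities
`X_T`. -/
def IsLittleOpOne (P : Measure Ω) (X : ℕ → Ω → ℝ≥0∞) : Prop :=
  ∀ ε : ℝ≥0∞, 0 < ε → Tendsto (fun T => P {ω | ε ≤ X T ω}) atTop (𝓝 0)

/-- Strict stationarity of `(X_t)_{t ≥ 1}`. -/
def IsStationary {E : Type*} [MeasurableSpace E] (P : Measure Ω) (X : ℕ → Ω → E) : Prop :=
  ∀ h : ℕ, P.map (fun ω (n : ℕ) => X (n + 1 + h) ω) = P.map (fun ω (n : ℕ) => X (n + 1) ω)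

/-- The σ-algebra generated by the `X_s` with `s ∈ I`. -/
abbrev sigmaOf {E : Type*} [MeasurableSpace E] (X : ℕ → Ω → E) (I : Set ℕ) : MeasurableSpace Ω :=
  ⨆ s ∈ I, MeasurableSpace.comap (X s) inferInstance

/-- Geometric strong mixing of `(X_t)_{t ≥ 1}`: the strong mixing coefficients satisfy
`sup_k sup {|P(F ∩ G) - P(F) P(G)| : F ∈ σ(X_s, s ≤ k), G ∈ σ(X_s, s ≥ k + h)} ≤ c ρ ^ h`. -/
def IsGeomStrongMixing {E : Type*} [MeasurableSpace E] (P : Measure Ω) (X : ℕ → Ω → E) : Prop :=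
  ∃ c ρ : ℝ, 0 < c ∧ 0 < ρ ∧ ρ < 1 ∧ ∀ k h : ℕ, 1 ≤ k → 1 ≤ h → ∀ F G : Set Ω,
    MeasurableSet[sigmaOf X (Set.Icc 1 k)] F → MeasurableSet[sigmaOf X (Set.Ici (k + h))] G →
      |P.real (F ∩ G) - P.real F * P.real G| ≤ c * ρ ^ h

variable {H : Type*} [NormedAddCommGroup H] [InnerProductSpace ℝ H]

/-- The operator `E[X ⊗ Y]`. -/
def momentOp (P : Measure Ω) (X Y : Ω → H) : H →L[ℝ] H := ∫ ω, tensor (X ω) (Y ω) ∂P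

/-- The sample operator `T⁻¹ ∑_{t=1}^T X_t ⊗ Y_t`. -/
def sampleOp (X Y : ℕ → Ω → H) (T : ℕ) (ω : Ω) : H →L[ℝ] H :=
  (T : ℝ)⁻¹ • ∑ t ∈ Finset.Icc 1 T, tensor (X t ω) (Y t ω)

/-- The information set `𝔉_{t-1} = σ({z_s}_{1 ≤ s ≤ t}, {u_s}_{1 ≤ s ≤ t-1})`. -/
abbrev pastSigma [MeasurableSpace H] (z u : ℕ → Ω → H) (t : ℕ) : MeasurableSpace Ω :=
  sigmaOf z (Set.Icc 1 t) ⊔ sigmaOf u (Set.Ico 1 t)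

/-! ### The estimator, from the observations `(y_t, x_t, z_t)`, `1 ≤ t ≤ T` -/

/-- `K₁`, the number of eigenvalues of the sample covariance of `z` with square above `α₁`. -/
def K₁ (z : ℕ → Ω → H) (α₁ : ℕ → ℝ) (T : ℕ) (ω : Ω) : ℕ :=
  truncLevel (sampleOp z z T ω) (α₁ T)

variable [CompleteSpace H]

/-- `P̂ = Ĉ_yz* (Ĉ_zz)_{K₁}⁻¹ Ĉ_xz`. -/
def hatP (y x z : ℕ → Ω → H) (α₁ : ℕ → ℝ) (T : ℕ) (ω : Ω) : H →L[ℝ] H :=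
  ContinuousLinearMap.adjoint (sampleOp y z T ω) ∘L
    regInv (sampleOp z z T ω) (K₁ z α₁ T ω) ∘L sampleOp x z T ω

/-- `Q̂ = Ĉ_xz* (Ĉ_zz)_{K₁}⁻¹ Ĉ_xz`. -/
def hatQ (x z : ℕ → Ω → H) (α₁ : ℕ → ℝ) (T : ℕ) (ω : Ω) : H →L[ℝ] H :=
  ContinuousLinearMap.adjoint (sampleOp x z T ω) ∘L
    regInv (sampleOp z z T ω) (K₁ z α₁ T ω) ∘L sampleOp x z T ω

/-- `K₂`, the number of eigenvalues of `Q̂` with square above `α₂`. -/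
def K₂ (x z : ℕ → Ω → H) (α₁ α₂ : ℕ → ℝ) (T : ℕ) (ω : Ω) : ℕ :=
  truncLevel (hatQ x z α₁ T ω) (α₂ T)

/-- The functional two-stage least square estimator `Ã = P̂ Q̂_{K₂}⁻¹`. -/
def f2slse (y x z : ℕ → Ω → H) (α₁ α₂ : ℕ → ℝ) (T : ℕ) (ω : Ω) : H →L[ℝ] H :=
  hatP y x z α₁ T ω ∘L regInv (hatQ x z α₁ T ω) (K₂ x z α₁ α₂ T ω)

/-- The orthogonal projection onto the span of the first `K₂` eigenvectors of `Q̂`. -/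
def tildeProj (x z : ℕ → Ω → H) (α₁ α₂ : ℕ → ℝ) (T : ℕ) (ω : Ω) : H →L[ℝ] H :=
  eigProj (hatQ x z α₁ T ω) (K₂ x z α₁ α₂ T ω)

/-! ### Population operators and the model -/

/-- `C_zz = E[z_t ⊗ z_t]`, which does not depend on `t` by stationarity. -/
def popCzz (P : Measure Ω) (z : ℕ → Ω → H) : H →L[ℝ] H := momentOp P (z 1) (z 1)

/-- `Q = C_xz* C_zz⁻¹ C_xz`. -/
def popQ (P : Measure Ω) (x z : ℕ → Ω → H) : H →L[ℝ] H :=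
  sandwichInv (popCzz P z) (momentOp P (x 1) (z 1))

/-- The functional linear simultaneous equation model `y_t = A x_t + u_t`, `x_t = B z_t + v_t`,
`t ≥ 1`, with instrument `z_t`, and the assumptions imposed on it. -/
structure Assumptions [MeasurableSpace H] (P : Measure Ω) (A B : H →L[ℝ] H)
    (y x z u v : ℕ → Ω → H) : Prop where
  /- `y_t, x_t, z_t, u_t, v_t` are random elements of `H`; `y_t, x_t, z_t` have mean zero -/
  measurable_y : ∀ t, 1 ≤ t → Measurable (y t)
  measurable_x : ∀ t, 1 ≤ t → Measurable (x t)
  measurable_z : ∀ t, 1 ≤ t → Measurable (z t)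
  measurable_u : ∀ t, 1 ≤ t → Measurable (u t)
  measurable_v : ∀ t, 1 ≤ t → Measurable (v t)
  mean_y : ∀ t, 1 ≤ t → ∫ ω, y t ω ∂P = 0
  mean_x : ∀ t, 1 ≤ t → ∫ ω, x t ω ∂P = 0
  mean_z : ∀ t, 1 ≤ t → ∫ ω, z t ω ∂P = 0
  /- the outcome equation, with endogenous regressor and centered error -/
  model : ∀ t, 1 ≤ t → ∀ᵐ ω ∂P, y t ω = A (x t ω) + u t ω
  endogenous : ∀ t, 1 ≤ t → momentOp P (x t) (u t) ≠ 0
  mean_u : ∀ t, 1 ≤ t → ∫ ω, u t ω ∂P = 0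
  /- weak dependence and second moments -/
  stationary : IsStationary P fun t ω => (x t ω, z t ω)
  mixing : IsGeomStrongMixing P fun t ω => (x t ω, z t ω)
  sq_integrable_x : ∀ t, 1 ≤ t → MemLp (x t) 2 P
  sq_integrable_z : ∀ t, 1 ≤ t → MemLp (z t) 2 P
  sq_integrable_u : ∀ t, 1 ≤ t → MemLp (u t) 2 P
  /- the errors are a homoscedastic martingale difference sequence; `C_uu = E[u_1 ⊗ u_1]` -/
  mart_diff : ∀ t, 1 ≤ t → P[u t | pastSigma z u t] =ᵐ[P] 0
  homoscedastic : ∀ t, 1 ≤ t →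
    P[fun ω => tensor (u t ω) (u t ω) | pastSigma z u t] =ᵐ[P] fun _ => momentOp P (u 1) (u 1)
  cond_moment : ∃ δ : ℝ, 0 < δ ∧ ∀ t, 1 ≤ t →
    ∀ᵐ ω ∂P, condLExp (pastSigma z u t) P (fun ω' => ‖u t ω'‖ₑ ^ (2 + δ)) ω < ∞
  /- the first-stage equation -/
  first_stage : ∀ t, 1 ≤ t → ∀ᵐ ω ∂P, x t ω = B (z t ω) + v t ω
  first_stage_orth : ∀ t, 1 ≤ t → momentOp P (z t) (v t) = 0
  mean_v : ∀ t, 1 ≤ t → ∫ ω, v t ω ∂P = 0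
  /- identification; `A` is Hilbert-Schmidt -/
  ker_Q : (popQ P x z).ker = ⊥
  hilbertSchmidt : hsNorm A < ∞
  /- distinct positive eigenvalues -/
  eigval_Czz : ∀ j, eigval (popCzz P z) (j + 1) < eigval (popCzz P z) j ∧ 0 < eigval (popCzz P z) j
  eigval_Q : ∀ j, eigval (popQ P x z) (j + 1) < eigval (popQ P x z) j ∧ 0 < eigval (popQ P x z) j
  /- convergence rates of the sample operators -/
  rate_xz : IsBigOp P (fun T ω => hsNorm (sampleOp x z T ω - momentOp P (x 1) (z 1)))
    fun T => (√(T : ℝ))⁻¹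
  rate_zz : IsBigOp P (fun T ω => hsNorm (sampleOp z z T ω - popCzz P z)) fun T => (√(T : ℝ))⁻¹
  rate_uz : IsBigOp P (fun T ω => hsNorm (sampleOp u z T ω - momentOp P (u 1) (z 1)))
    fun T => (√(T : ℝ))⁻¹
  rate_uu : IsLittleOpOne P fun T ω => hsNorm (sampleOp u u T ω - momentOp P (u 1) (u 1))
  rate_vz : IsBigOp P (fun T ω => hsNorm (sampleOp v z T ω)) fun T => (√(T : ℝ))⁻¹

end Stochastic

end F2SLS

end

/-!
Substituting `y = A x + u` shows that `Ã - A Π̃` is the estimator formed with `u` in place of `y`,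
that is `Ĉ_uz* R Ĉ_xz G`, where `R` and `G` are the regularized inverses of `Ĉ_zz` and
`Q̂ = Ĉ_xz* R Ĉ_xz`. Since `R` is positive and `G Q̂ G = G`, the Cauchy-Schwarz inequality for the
form `⟨R ·, ·⟩` gives `‖R Ĉ_xz G‖² ≤ ‖R‖ ‖G‖`; as every eigenvalue that is kept exceeds `√α₁`,
respectively `√α₂`, the right-hand side is at most `α₁^(-1/2) α₂^(-1/2)`, while
`‖Ĉ_uz‖² = O_p(T⁻¹)` because the martingale difference property makes `C_uz` vanish.

The first stage gives `Ĉ_xz = Ĉ_zz B* + Ĉ_vz` and `Q = B C_zz B*`. Discarding the eigenvalues of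
`Ĉ_zz` below `√α₁` costs at most `√α₁` in operator norm, so `Q̂ → Q` in probability. The bias
satisfies `‖A (I - Π̃)‖² ≤ ‖A* A (I - Π̃)‖`. Since `Q*` has dense range, the compact operator
`A* A` is a norm limit of operators of the form `S Q`, and `‖Q̂ (I - Π̃)‖ ≤ √α₂`.
-/

namespace F2SLS

open scoped InnerProduct

section RankOne

variable {H : Type*} [NormedAddCommGroup H] [InnerProductSpace ℝ H]

@[simp] theorem tensor_apply (a b ζ : H) : tensor a b ζ = (inner ℝ a ζ : ℝ) • b := rfl

theorem norm_tensor (a b : H) : ‖tensor a b‖ = ‖a‖ * ‖b‖ := by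
  rw [tensor, InnerProductSpace.norm_rankOne, mul_comm]

/-- The tensor product `a ⊗ b` as a continuous bilinear map, for which Mathlib's results on
measurability and conditional expectation of products apply. -/
noncomputable def tensorL : H →L[ℝ] H →L[ℝ] H →L[ℝ] H :=
  ContinuousLinearMap.smulRightL ℝ H H ∘L innerSL ℝ

@[simp] theorem tensorL_apply (a b : H) : tensorL a b = tensor a b := rfl

-- Unfolding `tensorL` sends the unifier astray in the conditional expectation argument below.
attribute [irreducible] tensorL

theorem comp_tensor (S : H →L[ℝ] H) (a b : H) : S ∘L tensor a b = tensor a (S b) :=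
  InnerProductSpace.comp_rankOne b a S

theorem isPositive_tensor_self (a : H) : (tensor a a).IsPositive :=
  InnerProductSpace.isPositive_rankOne_self a

theorem isCompactOperator_tensor (a b : H) : IsCompactOperator (tensor a b) :=
  (isCompactOperator_of_locallyCompactSpace_dom (innerSL ℝ a)).clm_comp
    (ContinuousLinearMap.toSpanSingleton ℝ b)

theorem isCompactOperator_sum {ι : Type*} {s : Finset ι} {F : ι → H →L[ℝ] H}
    (hF : ∀ i ∈ s, IsCompactOperator (F i)) : IsCompactOperator (∑ i ∈ s, F i : H →L[ℝ] H) :=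
  (compactOperator (RingHom.id ℝ) H H).sum_mem hF

variable [CompleteSpace H]

theorem tensor_comp (S : H →L[ℝ] H) (a b : H) : tensor a b ∘L S = tensor ((S†) a) b :=
  InnerProductSpace.rankOne_comp b a S

@[simp] theorem adjoint_tensor (a b : H) : (tensor a b)† = tensor b a :=
  InnerProductSpace.adjoint_rankOne b a

theorem tensor_map_add_left (S : H →L[ℝ] H) (a b c : H) :
    tensor (S a + b) c = tensor a c ∘L S† + tensor b c := by
  rw [tensor_comp, ContinuousLinearMap.adjoint_adjoint]
  simp only [← tensorL_apply, map_add, _root_.add_apply]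

end RankOne

section Orthonormal

variable {H : Type*} [NormedAddCommGroup H] [InnerProductSpace ℝ H] {e : ℕ → H}

theorem norm_sum_smul_tensor_le (he : Orthonormal ℝ e) (s : Finset ℕ) (c : ℕ → ℝ) {M : ℝ}
    (hM : 0 ≤ M) (hc : ∀ j ∈ s, |c j| ≤ M) : ‖∑ j ∈ s, c j • tensor (e j) (e j)‖ ≤ M := by
  refine ContinuousLinearMap.opNorm_le_bound _ hM fun x => le_of_sq_le_sq ?_ (by positivity)
  have hx : (∑ j ∈ s, c j • tensor (e j) (e j)) x = ∑ j ∈ s, (c j * inner ℝ (e j) x) • e j := by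
    simp [mul_smul]
  calc ‖(∑ j ∈ s, c j • tensor (e j) (e j)) x‖ ^ 2
      = ∑ j ∈ s, |c j| ^ 2 * ‖(inner ℝ (e j) x : ℝ)‖ ^ 2 := by
        rw [hx, ← real_inner_self_eq_norm_sq, he.inner_sum]
        exact Finset.sum_congr rfl fun j _ => by simp; ring
    _ ≤ ∑ j ∈ s, M ^ 2 * ‖(inner ℝ (e j) x : ℝ)‖ ^ 2 := by
        gcongr with j hj
        exact hc j hj
    _ ≤ M ^ 2 * ‖x‖ ^ 2 := by
        rw [← Finset.mul_sum]
        gcongr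
        exact he.sum_inner_products_le x
    _ = (M * ‖x‖) ^ 2 := (mul_pow ..).symm

theorem sum_smul_tensor_comp_sum_smul_tensor (he : Orthonormal ℝ e) (s : Finset ℕ)
    (c d : ℕ → ℝ) :
    (∑ j ∈ s, c j • tensor (e j) (e j)) ∘L (∑ j ∈ s, d j • tensor (e j) (e j)) =
      ∑ j ∈ s, (c j * d j) • tensor (e j) (e j) := by
  rw [ContinuousLinearMap.comp_finsetSum]
  refine Finset.sum_congr rfl fun i hi => ?_
  have hei : (∑ j ∈ s, c j • tensor (e j) (e j)) (e i) = c i • e i := by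
    simp [orthonormal_iff_ite.mp he, hi]
  rw [ContinuousLinearMap.comp_smul, comp_tensor, hei, mul_comm, mul_smul]
  simp only [← tensorL_apply, map_smul]

end Orthonormal

section EigenSystem

variable {H : Type*} [NormedAddCommGroup H] [InnerProductSpace ℝ H]
  {S : H →L[ℝ] H} {a : ℕ → ℝ} {e : ℕ → H}

theorem IsEigenSystem.tendsto_zero (h : IsEigenSystem S a e) : Tendsto a atTop (𝓝 0) := by
  have hdiff := ((tendsto_add_atTop_iff_nat 1).mpr h.tendsto).sub h.tendsto
  simp only [Finset.sum_range_succ, add_sub_cancel_left, sub_self] at hdiff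
  refine (tendsto_zero_iff_norm_tendsto_zero.mp hdiff).congr fun n => ?_
  rw [norm_smul, norm_tensor, h.orthonormal.1, Real.norm_of_nonneg (h.nonneg n), one_mul, mul_one]

theorem IsEigenSystem.norm_sum_smul_tensor_le (h : IsEigenSystem S a e) {K : ℕ} {s : Finset ℕ}
    (hs : ∀ j ∈ s, K ≤ j) : ‖∑ j ∈ s, a j • tensor (e j) (e j)‖ ≤ a K :=
  F2SLS.norm_sum_smul_tensor_le h.orthonormal s a (h.nonneg K) fun j hj => by
    rw [abs_of_nonneg (h.nonneg j)]
    exact h.antitone (hs j hj)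

theorem IsEigenSystem.norm_sub_sum_le (h : IsEigenSystem S a e) (K : ℕ) :
    ‖S - ∑ j ∈ Finset.range K, a j • tensor (e j) (e j)‖ ≤ a K := by
  refine le_of_tendsto (h.tendsto.sub_const _).norm ?_
  filter_upwards [eventually_ge_atTop K] with n hn
  rw [← Finset.sum_Ico_eq_sub _ hn]
  exact h.norm_sum_smul_tensor_le fun j hj => (Finset.mem_Ico.mp hj).1

theorem IsEigenSystem.hasSum [CompleteSpace H] (h : IsEigenSystem S a e) :
    HasSum (fun j => a j • tensor (e j) (e j)) S := by
  refine (Summable.hasSum_iff_tendsto_nat (summable_iff_vanishing_norm.mpr fun ε hε => ?_)).mpr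
    h.tendsto
  obtain ⟨K, hK⟩ := (h.tendsto_zero.eventually_lt_const hε).exists
  refine ⟨Finset.range K, fun s hs => (h.norm_sum_smul_tensor_le fun j hj => ?_).trans_lt hK⟩
  simpa using Finset.disjoint_left.mp hs hj

theorem IsEigenSystem.comp_tensor (h : IsEigenSystem S a e) (j : ℕ) :
    S ∘L tensor (e j) (e j) = a j • tensor (e j) (e j) := by
  refine tendsto_nhds_unique
    (((ContinuousLinearMap.compL ℝ H H H).flip (tensor (e j) (e j))).continuous.tendsto S |>.comp
      h.tendsto) (tendsto_const_nhds.congr' ?_)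
  filter_upwards [eventually_gt_atTop j] with n hn
  have hej : (∑ i ∈ Finset.range n, a i • tensor (e i) (e i)) (e j) = a j • e j := by
    simp [orthonormal_iff_ite.mp h.orthonormal, hn]
  simp only [Function.comp_apply, ContinuousLinearMap.flip_apply, ContinuousLinearMap.compL_apply,
    F2SLS.comp_tensor, hej]
  simp only [← tensorL_apply, map_smul]

theorem IsEigenSystem.comp_sum_smul_tensor (h : IsEigenSystem S a e) (s : Finset ℕ) (c : ℕ → ℝ) :
    S ∘L (∑ j ∈ s, c j • tensor (e j) (e j)) = ∑ j ∈ s, (a j * c j) • tensor (e j) (e j) := by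
  rw [ContinuousLinearMap.comp_finsetSum]
  refine Finset.sum_congr rfl fun j _ => ?_
  rw [ContinuousLinearMap.comp_smul, h.comp_tensor, smul_smul, mul_comm]

theorem IsEigenSystem.adjoint_eq [CompleteSpace H] (h : IsEigenSystem S a e) : S† = S :=
  tendsto_nhds_unique ((ContinuousLinearMap.adjoint.continuous.tendsto S).comp h.tendsto) <|
    h.tendsto.congr fun n => by simp

end EigenSystem

section Truncation

variable {H : Type*} [NormedAddCommGroup H] [InnerProductSpace ℝ H] {S : H →L[ℝ] H}

theorem isPositive_regInv (hS : IsEigenSystem S (eigval S) (eigvec S)) (K : ℕ) :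
    (regInv S K).IsPositive :=
  ContinuousLinearMap.isPositive_sum _ fun j _ =>
    (isPositive_tensor_self _).smul_of_nonneg (inv_nonneg.mpr (hS.nonneg j))

theorem isCompactOperator_regInv (S : H →L[ℝ] H) (K : ℕ) : IsCompactOperator (regInv S K) :=
  isCompactOperator_sum fun _ _ => (isCompactOperator_tensor _ _).smul _

theorem isStarProjection_eigProj [CompleteSpace H]
    (hS : IsEigenSystem S (eigval S) (eigvec S)) (K : ℕ) : IsStarProjection (eigProj S K) where
  isIdempotentElem := by
    rw [IsIdempotentElem, ContinuousLinearMap.mul_def]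
    simpa [eigProj] using
      sum_smul_tensor_comp_sum_smul_tensor hS.orthonormal (Finset.range K) 1 1
  isSelfAdjoint := by
    rw [ContinuousLinearMap.isSelfAdjoint_iff']
    simp [eigProj]

theorem lt_truncLevel_iff (hS : IsEigenSystem S (eigval S) (eigvec S)) {α : ℝ} (hα : 0 < α)
    {j : ℕ} : j < truncLevel S α ↔ √α < eigval S j := by
  have hset : {i | α < eigval S i ^ 2} = {i | √α < eigval S i} :=
    Set.ext fun i => by
      rw [Set.mem_ofPred_eq, Set.mem_ofPred_eq, ← Real.sqrt_lt_sqrt_iff hα.le,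
        Real.sqrt_sq (hS.nonneg i)]
  obtain ⟨n, hn⟩ : ∃ n, {i | √α < eigval S i} = Set.Iio n := by
    have hlower : IsLowerSet {i | √α < eigval S i} := fun i k hki hi =>
      lt_of_lt_of_le hi (hS.antitone hki)
    obtain ⟨k, hk⟩ := (hS.tendsto_zero.eventually_lt_const (Real.sqrt_pos.mpr hα)).exists
    refine hlower.eq_univ_or_Iio.resolve_left fun huniv => ?_
    exact hk.not_gt (Set.eq_univ_iff_forall.mp huniv k)
  rw [truncLevel, hset, hn, ← Finset.coe_Iio, Set.ncard_coe_finset, Nat.card_Iio]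
  exact (Set.ext_iff.mp hn j).symm

section

variable (hS : IsEigenSystem S (eigval S) (eigvec S)) {α : ℝ} (hα : 0 < α)
include hS hα

theorem norm_regInv_truncLevel_le : ‖regInv S (truncLevel S α)‖ ≤ (√α)⁻¹ :=
  norm_sum_smul_tensor_le hS.orthonormal _ _ (by positivity) fun j hj => by
    rw [abs_of_nonneg (inv_nonneg.mpr (hS.nonneg j))]
    have hlt := (lt_truncLevel_iff hS hα).mp (Finset.mem_range.mp hj)
    exact inv_anti₀ (Real.sqrt_pos.mpr hα) hlt.le

theorem comp_regInv_truncLevel : S ∘L regInv S (truncLevel S α) = eigProj S (truncLevel S α) := by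
  rw [regInv, hS.comp_sum_smul_tensor, eigProj]
  refine Finset.sum_congr rfl fun j hj => ?_
  have hpos : 0 < eigval S j :=
    (Real.sqrt_nonneg α).trans_lt ((lt_truncLevel_iff hS hα).mp (Finset.mem_range.mp hj))
  rw [mul_inv_cancel₀ hpos.ne', one_smul]

theorem regInv_truncLevel_comp [CompleteSpace H] :
    regInv S (truncLevel S α) ∘L S = eigProj S (truncLevel S α) := by
  have hadj := congrArg ContinuousLinearMap.adjoint (comp_regInv_truncLevel hS hα)
  rwa [ContinuousLinearMap.adjoint_comp, hS.adjoint_eq,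
    (isPositive_regInv hS _).isSelfAdjoint.adjoint_eq,
    (isStarProjection_eigProj hS _).isSelfAdjoint.adjoint_eq] at hadj

theorem regInv_truncLevel_comp_comp_regInv_truncLevel :
    regInv S (truncLevel S α) ∘L S ∘L regInv S (truncLevel S α) = regInv S (truncLevel S α) := by
  rw [comp_regInv_truncLevel hS hα]
  simpa [regInv, eigProj] using sum_smul_tensor_comp_sum_smul_tensor hS.orthonormal
    (Finset.range (truncLevel S α)) (fun j => (eigval S j)⁻¹) 1

theorem norm_sub_comp_eigProj_truncLevel_le : ‖S - S ∘L eigProj S (truncLevel S α)‖ ≤ √α := by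
  have hproj : S ∘L eigProj S (truncLevel S α) =
      ∑ j ∈ Finset.range (truncLevel S α), eigval S j • tensor (eigvec S j) (eigvec S j) := by
    simpa [eigProj] using hS.comp_sum_smul_tensor (Finset.range (truncLevel S α)) 1
  rw [hproj]
  exact (hS.norm_sub_sum_le _).trans
    (not_lt.mp fun hlt => lt_irrefl _ ((lt_truncLevel_iff hS hα).mpr hlt))

end

end Truncation

section HilbertSchmidt

variable {H : Type*} [NormedAddCommGroup H] [InnerProductSpace ℝ H] {ι : Type*}

theorem norm_sum_repr_smul_sq_le (b : HilbertBasis ι ℝ H) (S : H →L[ℝ] H) (x : H)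
    (s : Finset ι) :
    ‖∑ i ∈ s, b.repr x i • S (b i)‖ ^ 2 ≤ (∑ i ∈ s, ‖S (b i)‖ ^ 2) * ‖x‖ ^ 2 :=
  calc ‖∑ i ∈ s, b.repr x i • S (b i)‖ ^ 2
      ≤ (∑ i ∈ s, ‖S (b i)‖ * ‖(b.repr x i : ℝ)‖) ^ 2 := by
        gcongr
        refine (norm_sum_le _ _).trans_eq ?_
        simp only [norm_smul, mul_comm]
    _ ≤ (∑ i ∈ s, ‖S (b i)‖ ^ 2) * ∑ i ∈ s, ‖(b.repr x i : ℝ)‖ ^ 2 :=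
        Finset.sum_mul_sq_le_sq_mul_sq _ _ _
    _ ≤ (∑ i ∈ s, ‖S (b i)‖ ^ 2) * ‖x‖ ^ 2 := by
        gcongr
        simpa only [b.repr_apply_apply] using b.orthonormal.sum_inner_products_le x

theorem enorm_sq_le_tsum (b : HilbertBasis ι ℝ H) (S : H →L[ℝ] H) :
    ‖S‖ₑ ^ 2 ≤ ∑' i, ‖S (b i)‖ₑ ^ 2 := by
  have happly (x : H) : ‖S x‖ₑ ^ 2 ≤ (∑' i, ‖S (b i)‖ₑ ^ 2) * ‖x‖ₑ ^ 2 := by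
    have hsum : HasSum (fun i => b.repr x i • S (b i)) (S x) := by
      simpa using (b.hasSum_repr x).mapL S
    refine le_of_tendsto' (((ENNReal.continuous_pow 2).tendsto _).comp hsum.enorm) fun s => ?_
    have hpartial :
        ‖∑ i ∈ s, b.repr x i • S (b i)‖ₑ ^ 2 ≤ (∑ i ∈ s, ‖S (b i)‖ₑ ^ 2) * ‖x‖ₑ ^ 2 := by
      simp only [enorm_eq_nnnorm]
      norm_cast
      exact NNReal.coe_le_coe.mp (by simpa using norm_sum_repr_smul_sq_le b S x s)
    exact hpartial.trans (mul_le_mul_left (ENNReal.sum_le_tsum s) _)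
  rw [← ENNReal.rpow_two, ← ENNReal.le_rpow_inv_iff two_pos]
  refine S.opENorm_le_bound fun x => ?_
  rw [← ENNReal.rpow_le_rpow_iff two_pos, ENNReal.mul_rpow_of_nonneg _ _ zero_le_two,
    ENNReal.rpow_inv_rpow two_ne_zero]
  simpa only [ENNReal.rpow_two] using happly x

theorem enorm_sub_sum_tensor_sq_le_tsum (b : HilbertBasis ι ℝ H) (S : H →L[ℝ] H)
    (s : Finset ι) :
    ‖S - ∑ i ∈ s, tensor (b i) (S (b i))‖ₑ ^ 2 ≤ ∑' i : {i // i ∉ s}, ‖S (b i)‖ₑ ^ 2 := by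
  classical
  refine (enorm_sq_le_tsum b _).trans_eq ?_
  refine .trans (tsum_congr fun j => ?_) (tsum_subtype {i | i ∉ s} fun i => ‖S (b i)‖ₑ ^ 2).symm
  by_cases hj : j ∈ s <;>
    simp [orthonormal_iff_ite.mp b.orthonormal, hj]

theorem isCompactOperator_of_tsum_ne_top [CompleteSpace H] (b : HilbertBasis ι ℝ H)
    {S : H →L[ℝ] H} (hS : ∑' i, ‖S (b i)‖ₑ ^ 2 ≠ ∞) : IsCompactOperator S := by
  have htail : Tendsto (fun s : Finset ι => ‖S - ∑ i ∈ s, tensor (b i) (S (b i))‖ₑ ^ 2) atTop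
      (𝓝 0) :=
    tendsto_of_tendsto_of_tendsto_of_le_of_le tendsto_const_nhds
      (ENNReal.tendsto_tsum_compl_atTop_zero hS) (fun _ => zero_le)
      (enorm_sub_sum_tensor_sq_le_tsum b S)
  refine isCompactOperator_of_tendsto (l := atTop)
    (F := fun s : Finset ι => ∑ i ∈ s, tensor (b i) (S (b i))) ?_
    (.of_forall fun s => isCompactOperator_sum fun i _ => isCompactOperator_tensor _ _)
  rw [tendsto_iff_edist_tendsto_0]
  have hroot := htail.ennrpow_const ((2 : ℕ) : ℝ)⁻¹
  have hhalf : (0 : ℝ) < ((2 : ℕ) : ℝ)⁻¹ := by positivity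
  simpa only [ENNReal.pow_rpow_inv_natCast two_ne_zero, edist_comm (Finset.sum _ _) S,
    edist_eq_enorm_sub, ENNReal.zero_rpow_of_pos hhalf] using hroot

variable [CompleteSpace H]

theorem enorm_le_hsNorm (S : H →L[ℝ] H) : ‖S‖ₑ ≤ hsNorm S := by
  obtain ⟨b, hb⟩ := (exists_hilbertBasis ℝ H).choose_spec
  rw [hsNorm, one_div, ENNReal.le_rpow_inv_iff two_pos, ENNReal.rpow_two]
  simpa [hb] using enorm_sq_le_tsum b S

theorem isCompactOperator_of_hsNorm_lt_top {S : H →L[ℝ] H} (hS : hsNorm S < ∞) :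
    IsCompactOperator S := by
  obtain ⟨b, hb⟩ := (exists_hilbertBasis ℝ H).choose_spec
  refine isCompactOperator_of_tsum_ne_top b ?_
  rw [hsNorm, one_div, ENNReal.rpow_lt_top_iff_of_pos (by norm_num)] at hS
  simpa [hb] using hS.ne

end HilbertSchmidt

section PopulationOperator

variable {H : Type*} [NormedAddCommGroup H] [InnerProductSpace ℝ H] [CompleteSpace H]

theorem sandwichInv_comp_adjoint {D : H →L[ℝ] H} (hD : IsEigenSystem D (eigval D) (eigvec D))
    (B : H →L[ℝ] H) : sandwichInv D (D ∘L B†) = B ∘L D ∘L B† := by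
  have hsum := (hD.hasSum.mapL ((ContinuousLinearMap.compL ℝ H H H).flip (B†))).mapL
    (ContinuousLinearMap.compL ℝ H H H B)
  refine (tsum_congr fun j => ?_).trans hsum.tsum_eq
  have heig : D (eigvec D j) = eigval D j • eigvec D j := by
    have hnorm := hD.orthonormal.1 j
    simpa [hnorm] using congrArg (· (eigvec D j)) (hD.comp_tensor j)
  have hadj : ((D ∘L B†)†) (eigvec D j) = eigval D j • B (eigvec D j) := by
    simp [ContinuousLinearMap.adjoint_comp, hD.adjoint_eq, heig]
  have hscalar : (eigval D j)⁻¹ * (eigval D j * eigval D j) = eigval D j := by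
    rcases eq_or_ne (eigval D j) 0 with h0 | h0
    · simp [h0]
    · field_simp
  simp only [ContinuousLinearMap.flip_apply, ContinuousLinearMap.compL_apply, hadj]
  rw [ContinuousLinearMap.smul_comp, ContinuousLinearMap.comp_smul, tensor_comp, comp_tensor,
    ContinuousLinearMap.adjoint_adjoint]
  simp only [← tensorL_apply, map_smul, smul_apply, smul_smul, hscalar]

end PopulationOperator

section Moments

variable {Ω : Type*} [MeasurableSpace Ω] {P : Measure Ω} {H : Type*} [NormedAddCommGroup H]
  [InnerProductSpace ℝ H] {V X Y : Ω → H}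

theorem integrable_tensor (hX : MemLp X 2 P) (hY : MemLp Y 2 P) :
    Integrable (fun ω => tensor (X ω) (Y ω)) P := by
  have hmeas := (tensorL (H := H)).aestronglyMeasurable_comp₂ hX.aestronglyMeasurable
    hY.aestronglyMeasurable
  simp only [tensorL_apply] at hmeas
  refine (hX.norm.integrable_mul hY.norm).mono hmeas (.of_forall fun ω => ?_)
  simp [norm_tensor]

theorem isCompactOperator_momentOp [CompleteSpace H] [IsProbabilityMeasure P]
    (hX : MemLp X 2 P) (hY : MemLp Y 2 P) : IsCompactOperator (momentOp P X Y) :=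
  (compactOperator (RingHom.id ℝ) H H).convex.integral_mem isClosed_setOfPred_isCompactOperator
    (.of_forall fun ω => isCompactOperator_tensor (X ω) (Y ω)) (integrable_tensor hX hY)

variable [CompleteSpace H]

theorem inner_momentOp_apply (hX : MemLp X 2 P) (hY : MemLp Y 2 P) (ζ η : H) :
    inner ℝ η (momentOp P X Y ζ) = ∫ ω, (inner ℝ (X ω) ζ * inner ℝ (Y ω) η : ℝ) ∂P := by
  have hi := integrable_tensor hX hY
  rw [momentOp, ContinuousLinearMap.integral_apply hi,
    ← integral_inner (hi.apply_continuousLinearMap ζ)]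
  simp only [tensor_apply, inner_smul_right, real_inner_comm]

theorem adjoint_momentOp (hX : MemLp X 2 P) (hY : MemLp Y 2 P) :
    (momentOp P X Y)† = momentOp P Y X := by
  refine ((ContinuousLinearMap.eq_adjoint_iff _ _).mpr fun ζ η => ?_).symm
  rw [real_inner_comm, inner_momentOp_apply hX hY, inner_momentOp_apply hY hX]
  simp only [mul_comm]

theorem isPositive_momentOp_self (hX : MemLp X 2 P) : (momentOp P X X).IsPositive := by
  refine ⟨(ContinuousLinearMap.isSelfAdjoint_iff'.mpr (adjoint_momentOp hX hX)).isSymmetric,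
    fun ζ => ?_⟩
  rw [ContinuousLinearMap.reApplyInnerSelf_apply, RCLike.re_to_real, real_inner_comm,
    inner_momentOp_apply hX hX]
  exact integral_nonneg fun ω => mul_self_nonneg _

theorem momentOp_map_add_left (S : H →L[ℝ] H) (hX : MemLp X 2 P) (hV : MemLp V 2 P)
    (hY : MemLp Y 2 P) :
    momentOp P (fun ω => S (X ω) + V ω) Y = momentOp P X Y ∘L S† + momentOp P V Y := by
  let precomp := (ContinuousLinearMap.compL ℝ H H H).flip (S†)
  have hcomm := precomp.integral_comp_comm (integrable_tensor hX hY)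
  have hint := precomp.integrable_comp (integrable_tensor hX hY)
  simp only [precomp, ContinuousLinearMap.flip_apply, ContinuousLinearMap.compL_apply]
    at hcomm hint
  simp only [momentOp, tensor_map_add_left]
  rw [integral_add hint (integrable_tensor hV hY), hcomm]

end Moments

theorem momentOp_eq_zero_of_condExp {Ω : Type*} {m mΩ : MeasurableSpace Ω} {P : Measure Ω}
    [IsFiniteMeasure P] {H : Type*} [NormedAddCommGroup H] [InnerProductSpace ℝ H]
    [CompleteSpace H] {X Y : Ω → H} (hm : m ≤ mΩ) (hX : MemLp X 2 P) (hY : MemLp Y 2 P)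
    (hYm : StronglyMeasurable[m] Y) (h0 : P[X | m] =ᵐ[P] 0) : momentOp P X Y = 0 := by
  have hint : Integrable (fun ω => tensorL (X ω) (Y ω)) P := by
    simpa only [tensorL_apply] using integrable_tensor hX hY
  have hcond : P[fun ω => tensor (X ω) (Y ω) | m] =ᵐ[P] fun ω => tensor (P[X | m] ω) (Y ω) := by
    simpa only [tensorL_apply] using
      condExp_bilin_of_stronglyMeasurable_right tensorL hYm hint (hX.integrable one_le_two)
  rw [momentOp, ← integral_condExp hm]
  refine integral_eq_zero_of_ae (hcond.trans (h0.mono fun ω hω => ?_))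
  simp only [← tensorL_apply, hω, Pi.zero_apply, map_zero, _root_.zero_apply]

section SampleOperators

variable {Ω : Type*} {H : Type*} [NormedAddCommGroup H] [InnerProductSpace ℝ H] [CompleteSpace H]

theorem isEigenSystem_sampleOp (hinf : ¬ FiniteDimensional ℝ H) (X : ℕ → Ω → H) (T : ℕ) (ω : Ω) :
    IsEigenSystem (sampleOp X X T ω) (eigval (sampleOp X X T ω)) (eigvec (sampleOp X X T ω)) :=
  isEigenSystem_eigval_eigvec hinf _
    ((isCompactOperator_sum fun _ _ => isCompactOperator_tensor _ _).smul _)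
    ((ContinuousLinearMap.isPositive_sum _ fun _ _ => isPositive_tensor_self _).smul_of_nonneg
      (by positivity))

theorem sampleOp_eq_comp_adjoint_add {V X Y Z : ℕ → Ω → H} {T : ℕ} {ω : Ω} {S : H →L[ℝ] H}
    (hX : ∀ t, 1 ≤ t → X t ω = S (Z t ω) + V t ω) :
    sampleOp X Y T ω = sampleOp Z Y T ω ∘L S† + sampleOp V Y T ω := by
  have hterm : ∀ t ∈ Finset.Icc 1 T,
      tensor (X t ω) (Y t ω) = tensor (Z t ω) (Y t ω) ∘L S† + tensor (V t ω) (Y t ω) :=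
    fun t ht => by rw [hX t (Finset.mem_Icc.mp ht).1, tensor_map_add_left]
  rw [sampleOp, Finset.sum_congr rfl hterm, Finset.sum_add_distrib, smul_add,
    ← ContinuousLinearMap.finsetSum_comp, ← ContinuousLinearMap.smul_comp, sampleOp, sampleOp]

end SampleOperators

section OperatorBounds

theorem star_mul_star_add_mul_mul_sub_eq {R : Type*} [Ring R] [StarRing R] {s r p : R}
    (b d v : R) (hs : IsSelfAdjoint s) (hsr : s * r = p) (hrs : r * s = p) :
    star (s * star b + v) * r * (s * star b + v) - b * d * star b =
      b * (s * p - d) * star b + b * p * v + star v * p * star b + star v * r * v := by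
  have hstar : star (s * star b + v) = b * s + star v := by
    rw [star_add, star_mul, star_star, hs.star_eq]
  have hexpand : (b * s + star v) * r * (s * star b + v) =
      b * (s * (r * s)) * star b + b * (s * r) * v + star v * (r * s) * star b +
        star v * r * v := by noncomm_ring
  rw [hstar, hexpand, hrs, hsr]
  noncomm_ring

theorem norm_star_mul_star_add_mul_mul_sub_le {R : Type*} [NormedRing R] [StarRing R]
    [NormedStarGroup R] {s r p : R} (b d v : R) (hs : IsSelfAdjoint s) (hsr : s * r = p)
    (hrs : r * s = p) (hp : ‖p‖ ≤ 1) :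
    ‖star (s * star b + v) * r * (s * star b + v) - b * d * star b‖ ≤
      ‖b‖ ^ 2 * ‖s * p - d‖ + 2 * ‖b‖ * ‖v‖ + ‖v‖ ^ 2 * ‖r‖ := by
  rw [star_mul_star_add_mul_mul_sub_eq b d v hs hsr hrs]
  refine norm_add₄_le.trans ?_
  calc ‖b * (s * p - d) * star b‖ + ‖b * p * v‖ + ‖star v * p * star b‖ + ‖star v * r * v‖
      ≤ ‖b‖ * ‖s * p - d‖ * ‖star b‖ + ‖b‖ * ‖p‖ * ‖v‖ + ‖star v‖ * ‖p‖ * ‖star b‖ +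
          ‖star v‖ * ‖r‖ * ‖v‖ := by
        gcongr <;> exact norm_mul₃_le
    _ ≤ ‖b‖ * ‖s * p - d‖ * ‖star b‖ + ‖b‖ * 1 * ‖v‖ + ‖star v‖ * 1 * ‖star b‖ +
          ‖star v‖ * ‖r‖ * ‖v‖ := by gcongr
    _ = ‖b‖ ^ 2 * ‖s * p - d‖ + 2 * ‖b‖ * ‖v‖ + ‖v‖ ^ 2 * ‖r‖ := by
        rw [norm_star, norm_star]
        ring

variable {H : Type*} [NormedAddCommGroup H] [InnerProductSpace ℝ H]

theorem norm_apply_sq_le_mul_inner {R : H →L[ℝ] H} (hR : R.IsPositive) (x : H) :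
    ‖R x‖ ^ 2 ≤ ‖R‖ * inner ℝ (R x) x := by
  rcases eq_or_ne (R x) 0 with h0 | h0
  · simp [h0]
  let form : LinearMap.BilinForm ℝ H := (innerₗ H).comp (R : H →ₗ[ℝ] H)
  have hsymm : LinearMap.IsSymm form := ⟨fun v w => by
    simpa [form, real_inner_comm v] using hR.isSymmetric v w⟩
  have hcauchy : (inner ℝ (R x) (R x) : ℝ) ^ 2 ≤ inner ℝ (R x) x * inner ℝ (R (R x)) (R x) :=
    form.apply_sq_le_of_symm hR.re_inner_nonneg_left hsymm x (R x)
  refine le_of_mul_le_mul_right ?_ (show 0 < ‖R x‖ ^ 2 by positivity)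
  calc ‖R x‖ ^ 2 * ‖R x‖ ^ 2 ≤ inner ℝ (R x) x * inner ℝ (R (R x)) (R x) := by
        rwa [← sq, ← real_inner_self_eq_norm_sq]
    _ ≤ inner ℝ (R x) x * (‖R‖ * ‖R x‖ * ‖R x‖) := by
        gcongr
        · exact hR.re_inner_nonneg_left x
        · exact (real_inner_le_norm _ _).trans (by gcongr; exact R.le_opNorm _)
    _ = ‖R‖ * inner ℝ (R x) x * ‖R x‖ ^ 2 := by ring

variable [CompleteSpace H]

theorem norm_comp_sq_le_norm_mul_norm_adjoint_conj {R : H →L[ℝ] H} (hR : R.IsPositive)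
    (T : H →L[ℝ] H) : ‖R ∘L T‖ ^ 2 ≤ ‖R‖ * ‖T† ∘L R ∘L T‖ := by
  refine (Real.le_sqrt (norm_nonneg _) (by positivity)).mp ?_
  refine ContinuousLinearMap.opNorm_le_bound _ (Real.sqrt_nonneg _) fun x => ?_
  refine le_of_sq_le_sq ?_ (by positivity)
  calc ‖R (T x)‖ ^ 2 ≤ ‖R‖ * inner ℝ (R (T x)) (T x) := norm_apply_sq_le_mul_inner hR _
    _ = ‖R‖ * inner ℝ ((T† ∘L R ∘L T) x) x := by
        simp [ContinuousLinearMap.adjoint_inner_left]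
    _ ≤ ‖R‖ * (‖T† ∘L R ∘L T‖ * ‖x‖ * ‖x‖) := by
        gcongr
        exact (real_inner_le_norm _ _).trans (by gcongr; exact ContinuousLinearMap.le_opNorm _ _)
    _ = (√(‖R‖ * ‖T† ∘L R ∘L T‖) * ‖x‖) ^ 2 := by
        rw [mul_pow, Real.sq_sqrt (by positivity)]
        ring

theorem norm_comp_comp_sq_le_norm_mul_norm {R C G : H →L[ℝ] H} (hR : R.IsPositive)
    (hG : IsSelfAdjoint G) (hGG : G ∘L (C† ∘L R ∘L C) ∘L G = G) :
    ‖R ∘L C ∘L G‖ ^ 2 ≤ ‖R‖ * ‖G‖ := by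
  have hconj : (C ∘L G)† ∘L R ∘L C ∘L G = G := by
    rw [ContinuousLinearMap.adjoint_comp, hG.adjoint_eq]
    exact hGG
  simpa only [hconj] using norm_comp_sq_le_norm_mul_norm_adjoint_conj hR (C ∘L G)

theorem norm_adjoint_comp_regInv_comp_regInv_sq_le (C U : H →L[ℝ] H) {D Q : H →L[ℝ] H} {α β : ℝ}
    (hα : 0 < α) (hβ : 0 < β) (hD : IsEigenSystem D (eigval D) (eigvec D))
    (hQ : IsEigenSystem Q (eigval Q) (eigvec Q)) (hQC : Q = C† ∘L regInv D (truncLevel D α) ∘L C) :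
    ‖U† ∘L regInv D (truncLevel D α) ∘L C ∘L regInv Q (truncLevel Q β)‖ ^ 2 ≤
      ‖U‖ ^ 2 * ((√α)⁻¹ * (√β)⁻¹) := by
  have hQQ := regInv_truncLevel_comp_comp_regInv_truncLevel hQ hβ
  have hG := norm_regInv_truncLevel_le hQ hβ
  have hGsa := (isPositive_regInv hQ (truncLevel Q β)).isSelfAdjoint
  generalize regInv Q (truncLevel Q β) = G at *
  subst hQC
  calc ‖U† ∘L regInv D (truncLevel D α) ∘L C ∘L G‖ ^ 2
      ≤ (‖U‖ * ‖regInv D (truncLevel D α) ∘L C ∘L G‖) ^ 2 := by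
        gcongr
        simpa using (U†).opNorm_comp_le (regInv D (truncLevel D α) ∘L C ∘L G)
    _ ≤ ‖U‖ ^ 2 * (‖regInv D (truncLevel D α)‖ * ‖G‖) := by
        rw [mul_pow]
        gcongr
        exact norm_comp_comp_sq_le_norm_mul_norm (isPositive_regInv hD _) hGsa hQQ
    _ ≤ ‖U‖ ^ 2 * ((√α)⁻¹ * (√β)⁻¹) := by
        gcongr
        exact norm_regInv_truncLevel_le hD hα

theorem isEigenSystem_adjoint_comp_regInv_comp (hinf : ¬ FiniteDimensional ℝ H) {D : H →L[ℝ] H}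
    (hD : IsEigenSystem D (eigval D) (eigvec D)) (C : H →L[ℝ] H) (K : ℕ) :
    IsEigenSystem (C† ∘L regInv D K ∘L C) (eigval (C† ∘L regInv D K ∘L C))
      (eigvec (C† ∘L regInv D K ∘L C)) :=
  isEigenSystem_eigval_eigvec hinf _
    (((isCompactOperator_regInv D K).comp_clm C).clm_comp (C†))
    ((isPositive_regInv hD K).adjoint_conj C)

theorem norm_adjoint_conj_regInv_sub_le (B D V : H →L[ℝ] H) {S : H →L[ℝ] H} {α : ℝ} (hα : 0 < α)
    (hS : IsEigenSystem S (eigval S) (eigvec S)) :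
    ‖(S ∘L B† + V)† ∘L regInv S (truncLevel S α) ∘L (S ∘L B† + V) - B ∘L D ∘L B†‖ ≤
      ‖B‖ ^ 2 * (‖S - D‖ + √α) + 2 * ‖B‖ * ‖V‖ + ‖V‖ ^ 2 * (√α)⁻¹ := by
  have hdist : ‖S ∘L eigProj S (truncLevel S α) - D‖ ≤ ‖S - D‖ + √α := by
    rw [← sub_sub_sub_cancel_left _ _ S]
    exact (norm_sub_le _ _).trans (by gcongr; exact norm_sub_comp_eigProj_truncLevel_le hS hα)
  calc _ ≤ ‖B‖ ^ 2 * ‖S ∘L eigProj S (truncLevel S α) - D‖ + 2 * ‖B‖ * ‖V‖ +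
          ‖V‖ ^ 2 * ‖regInv S (truncLevel S α)‖ :=
        norm_star_mul_star_add_mul_mul_sub_le B D V hS.adjoint_eq (comp_regInv_truncLevel hS hα)
          (regInv_truncLevel_comp hS hα) (isStarProjection_eigProj hS _).norm_le
    _ ≤ _ := by
        gcongr
        exact norm_regInv_truncLevel_le hS hα

theorem norm_comp_one_sub_sq_le (A G Q S : H →L[ℝ] H) {p : H →L[ℝ] H} (hp : IsStarProjection p) :
    ‖A ∘L (.id ℝ H - p)‖ ^ 2 ≤ ‖A† ∘L A - G ∘L Q‖ + ‖G‖ * (‖S - Q‖ + ‖S - S ∘L p‖) := by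
  have hq := hp.one_sub
  change ‖A * (1 - p)‖ ^ 2 ≤ ‖star A * A - G * Q‖ + ‖G‖ * (‖S - Q‖ + ‖S - S * p‖)
  have hfactor : star A * A * (1 - p) =
      (star A * A - G * Q) * (1 - p) + G * ((S - S * p) - (S - Q) * (1 - p)) := by noncomm_ring
  calc ‖A * (1 - p)‖ ^ 2 = ‖(1 - p) * (star A * A * (1 - p))‖ := by
        rw [sq, ← CStarRing.norm_star_mul_self, star_mul, hq.isSelfAdjoint.star_eq]
        simp only [mul_assoc]
    _ ≤ 1 * ‖star A * A * (1 - p)‖ := by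
        grw [norm_mul_le, hq.norm_le]
    _ ≤ ‖star A * A - G * Q‖ * 1 + ‖G‖ * (‖S - S * p‖ + ‖S - Q‖ * 1) := by
        rw [one_mul, hfactor]
        grw [norm_add_le, norm_mul_le, norm_mul_le G, norm_sub_le (S - S * p), norm_mul_le (S - Q),
          hq.norm_le]
    _ = _ := by ring

end OperatorBounds

section BoundsInProbability

variable {Ω : Type*} [MeasurableSpace Ω] {P : Measure Ω} {X Y : ℕ → Ω → ℝ≥0∞} {r : ℕ → ℝ}

theorem isLittleOpOne_of_forall_le_imp_le
    (h : ∀ ε, 0 < ε → ∃ Y, IsLittleOpOne P Y ∧ ∃ δ, 0 < δ ∧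
      ∀ T, ∀ᵐ ω ∂P, ε ≤ X T ω → δ ≤ Y T ω) : IsLittleOpOne P X := fun ε hε => by
  obtain ⟨Y, hY, δ, hδ, hXY⟩ := h ε hε
  exact tendsto_of_tendsto_of_tendsto_of_le_of_le tendsto_const_nhds (hY δ hδ)
    (fun _ => zero_le) fun T => measure_mono_ae (hXY T)

theorem IsLittleOpOne.mono (hY : IsLittleOpOne P Y) (h : ∀ T, ∀ᵐ ω ∂P, X T ω ≤ Y T ω) :
    IsLittleOpOne P X :=
  isLittleOpOne_of_forall_le_imp_le fun ε hε =>
    ⟨Y, hY, ε, hε, fun T => (h T).mono fun _ hXY hεX => hεX.trans hXY⟩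

theorem IsLittleOpOne.const_mul (hX : IsLittleOpOne P X) {c : ℝ≥0∞} (hc : c ≠ ∞) :
    IsLittleOpOne P fun T ω => c * X T ω :=
  isLittleOpOne_of_forall_le_imp_le fun ε hε =>
    ⟨X, hX, ε / c, ENNReal.div_pos hε.ne' hc, fun _ => .of_forall fun _ =>
      ENNReal.div_le_of_le_mul'⟩

theorem IsLittleOpOne.of_sq (hX : IsLittleOpOne P fun T ω => X T ω ^ 2) : IsLittleOpOne P X :=
  isLittleOpOne_of_forall_le_imp_le fun ε hε =>
    ⟨_, hX, ε ^ 2, ENNReal.pow_pos hε 2, fun _ => .of_forall fun _ hεX => by gcongr⟩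

theorem isLittleOpOne_of_forall_le_add
    (h : ∀ δ, 0 < δ → ∃ Y, IsLittleOpOne P Y ∧ ∀ T ω, X T ω ≤ δ + Y T ω) :
    IsLittleOpOne P X := by
  refine isLittleOpOne_of_forall_le_imp_le fun ε hε => ?_
  obtain ⟨δ, hδ, hδε⟩ := exists_between hε
  obtain ⟨Y, hY, hXY⟩ := h δ hδ
  refine ⟨Y, hY, ε - δ, tsub_pos_of_lt hδε, fun T => .of_forall fun ω hεX => ?_⟩
  exact tsub_le_iff_left.mpr (hεX.trans (hXY T ω))

theorem IsLittleOpOne.add (hX : IsLittleOpOne P X) (hY : IsLittleOpOne P Y) :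
    IsLittleOpOne P fun T ω => X T ω + Y T ω := fun ε hε => by
  have hε2 : 0 < ε / 2 := ENNReal.half_pos hε.ne'
  have hlim := (hX _ hε2).add (hY _ hε2)
  rw [add_zero] at hlim
  refine tendsto_of_tendsto_of_tendsto_of_le_of_le tendsto_const_nhds hlim (fun _ => zero_le)
    fun T => (measure_mono fun ω hω => ?_).trans (measure_union_le _ _)
  contrapose! hω
  simp only [Set.mem_union, Set.mem_ofPred_eq, not_or, not_le] at hω ⊢
  simpa only [ENNReal.add_halves] using ENNReal.add_lt_add hω.1 hω.2

theorem IsBigOp.mono (hY : IsBigOp P Y r) (h : ∀ T, ∀ᵐ ω ∂P, X T ω ≤ Y T ω) :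
    IsBigOp P X r := fun ε hε => by
  obtain ⟨M, hM, hYM⟩ := hY ε hε
  refine ⟨M, hM, hYM.mono fun T hT => (measure_mono_ae ?_).trans hT⟩
  exact (h T).mono fun _ hXY hMX => lt_of_lt_of_le hMX hXY

theorem IsBigOp.isLittleOpOne (hX : IsBigOp P X r) (hr : Tendsto r atTop (𝓝 0)) :
    IsLittleOpOne P X := fun ε hε => by
  refine ENNReal.tendsto_nhds_zero.mpr fun η hη => ?_
  obtain ⟨M, -, hXM⟩ := hX η hη
  have hlim : Tendsto (fun T => ENNReal.ofReal (M * r T)) atTop (𝓝 0) := by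
    simpa using ENNReal.tendsto_ofReal (hr.const_mul M)
  filter_upwards [hXM, hlim.eventually_lt_const hε] with T hT hMε
  exact (measure_mono fun _ hεX => lt_of_lt_of_le hMε hεX).trans hT

theorem isBigOp_ofReal (P : Measure Ω) (r : ℕ → ℝ) :
    IsBigOp P (fun T _ => ENNReal.ofReal (r T)) r := fun ε _ =>
  ⟨1, one_pos, .of_forall fun T => by simp⟩

theorem IsBigOp.sq_mul_ofReal (hX : IsBigOp P X r) (s : ℕ → ℝ) :
    IsBigOp P (fun T ω => X T ω ^ 2 * ENNReal.ofReal (s T)) fun T => r T ^ 2 * s T :=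
  fun ε hε => by
  obtain ⟨M, hM, hXM⟩ := hX ε hε
  refine ⟨M ^ 2, by positivity, hXM.mono fun T hT => (measure_mono fun ω hω => ?_).trans hT⟩
  contrapose! hω
  simp only [Set.mem_ofPred_eq, not_lt] at hω ⊢
  have hsq : ENNReal.ofReal (M * r T) ^ 2 ≤ ENNReal.ofReal ((M * r T) ^ 2) := by
    rcases le_total 0 (M * r T) with h0 | h0
    · rw [ENNReal.ofReal_pow h0]
    · simp [ENNReal.ofReal_of_nonpos h0]
  calc X T ω ^ 2 * ENNReal.ofReal (s T)
      ≤ ENNReal.ofReal ((M * r T) ^ 2) * ENNReal.ofReal (s T) := by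
        gcongr
        exact (pow_le_pow_left' hω 2).trans hsq
    _ = ENNReal.ofReal (M ^ 2 * (r T ^ 2 * s T)) := by
        rw [← ENNReal.ofReal_mul (sq_nonneg _)]
        ring_nf

end BoundsInProbability

section Density

variable {H : Type*} [NormedAddCommGroup H] [InnerProductSpace ℝ H] [CompleteSpace H]

theorem denseRange_adjoint {Q : H →L[ℝ] H} (hQ : Q.ker = ⊥) : DenseRange (Q†) := by
  have hdense : Dense ((Q†).range : Set H) := by
    rw [Submodule.dense_iff_topologicalClosure_eq_top, Submodule.topologicalClosure_eq_top_iff,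
      ContinuousLinearMap.orthogonal_range, ContinuousLinearMap.adjoint_adjoint, hQ]
  exact hdense

theorem tensor_mem_closure_range_comp {Q : H →L[ℝ] H} (hQ : Q.ker = ⊥) (a b : H) :
    tensor a b ∈ closure (Set.range fun G : H →L[ℝ] H => G ∘L Q) := by
  have hcont : Continuous fun c => tensor c b := by
    simp only [← tensorL_apply]
    exact (tensorL.flip b).continuous
  refine map_mem_closure (f := fun c => tensor c b) hcont (denseRange_adjoint hQ a) ?_
  rintro _ ⟨c, rfl⟩
  exact ⟨tensor c b, tensor_comp Q c b⟩

theorem IsEigenSystem.exists_norm_sub_comp_lt {S Q : H →L[ℝ] H} {a : ℕ → ℝ} {e : ℕ → H}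
    (h : IsEigenSystem S a e) (hQ : Q.ker = ⊥) {ε : ℝ} (hε : 0 < ε) :
    ∃ G : H →L[ℝ] H, ‖S - G ∘L Q‖ < ε := by
  let W := ((ContinuousLinearMap.compL ℝ H H H).flip Q).range
  have hS : S ∈ W.topologicalClosure :=
    W.isClosed_topologicalClosure.mem_of_tendsto h.tendsto <| .of_forall fun n =>
      W.topologicalClosure.sum_mem fun j _ => W.topologicalClosure.smul_mem _
        (tensor_mem_closure_range_comp hQ (e j) (e j))
  obtain ⟨_, ⟨G, rfl⟩, hG⟩ := Metric.mem_closure_iff.mp hS ε hε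
  exact ⟨G, by rwa [dist_eq_norm] at hG⟩

end Density

section Estimator

variable {Ω : Type*} {H : Type*} [NormedAddCommGroup H] [InnerProductSpace ℝ H] [CompleteSpace H]
  {A B : H →L[ℝ] H} {y x z u v : ℕ → Ω → H} {α₁ α₂ : ℕ → ℝ} {T : ℕ} {ω : Ω}

theorem isEigenSystem_hatQ (hinf : ¬ FiniteDimensional ℝ H) (x z : ℕ → Ω → H) (α₁ : ℕ → ℝ)
    (T : ℕ) (ω : Ω) :
    IsEigenSystem (hatQ x z α₁ T ω) (eigval (hatQ x z α₁ T ω)) (eigvec (hatQ x z α₁ T ω)) :=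
  isEigenSystem_adjoint_comp_regInv_comp hinf (isEigenSystem_sampleOp hinf z T ω) _ _

theorem hatP_eq (hy : ∀ t, 1 ≤ t → y t ω = A (x t ω) + u t ω) :
    hatP y x z α₁ T ω = A ∘L hatQ x z α₁ T ω + hatP u x z α₁ T ω := by
  rw [hatP, sampleOp_eq_comp_adjoint_add hy, map_add, ContinuousLinearMap.adjoint_comp,
    ContinuousLinearMap.adjoint_adjoint, ContinuousLinearMap.add_comp]
  rfl

theorem f2slse_sub_eq (hinf : ¬ FiniteDimensional ℝ H) (hα₂ : 0 < α₂ T)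
    (hy : ∀ t, 1 ≤ t → y t ω = A (x t ω) + u t ω) :
    f2slse y x z α₁ α₂ T ω - A ∘L tildeProj x z α₁ α₂ T ω = f2slse u x z α₁ α₂ T ω := by
  have hproj : hatQ x z α₁ T ω ∘L regInv (hatQ x z α₁ T ω) (K₂ x z α₁ α₂ T ω) =
      tildeProj x z α₁ α₂ T ω :=
    comp_regInv_truncLevel (isEigenSystem_hatQ hinf x z α₁ T ω) hα₂
  rw [f2slse, hatP_eq hy, ContinuousLinearMap.add_comp, ContinuousLinearMap.comp_assoc, hproj,
    add_sub_cancel_left, f2slse]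

theorem norm_f2slse_sq_le (hinf : ¬ FiniteDimensional ℝ H) (hα₁ : 0 < α₁ T) (hα₂ : 0 < α₂ T) :
    ‖f2slse u x z α₁ α₂ T ω‖ ^ 2 ≤
      ‖sampleOp u z T ω‖ ^ 2 * ((√(α₁ T))⁻¹ * (√(α₂ T))⁻¹) := by
  rw [f2slse, hatP, ContinuousLinearMap.comp_assoc, ContinuousLinearMap.comp_assoc]
  exact norm_adjoint_comp_regInv_comp_regInv_sq_le _ _ hα₁ hα₂ (isEigenSystem_sampleOp hinf z T ω)
    (isEigenSystem_hatQ hinf x z α₁ T ω) rfl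

theorem norm_hatQ_sub_le (hinf : ¬ FiniteDimensional ℝ H) (D : H →L[ℝ] H) (hα₁ : 0 < α₁ T)
    (hx : ∀ t, 1 ≤ t → x t ω = B (z t ω) + v t ω) :
    ‖hatQ x z α₁ T ω - B ∘L D ∘L B†‖ ≤ ‖B‖ ^ 2 * (‖sampleOp z z T ω - D‖ + √(α₁ T)) +
      2 * ‖B‖ * ‖sampleOp v z T ω‖ + ‖sampleOp v z T ω‖ ^ 2 * (√(α₁ T))⁻¹ := by
  rw [hatQ, sampleOp_eq_comp_adjoint_add hx]
  exact norm_adjoint_conj_regInv_sub_le B D _ hα₁ (isEigenSystem_sampleOp hinf z T ω)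

theorem norm_comp_id_sub_tildeProj_sq_le (hinf : ¬ FiniteDimensional ℝ H) (A G Q : H →L[ℝ] H)
    (hα₂ : 0 < α₂ T) :
    ‖A ∘L (.id ℝ H - tildeProj x z α₁ α₂ T ω)‖ ^ 2 ≤
      ‖A† ∘L A - G ∘L Q‖ + ‖G‖ * (‖hatQ x z α₁ T ω - Q‖ + √(α₂ T)) := by
  have hS := isEigenSystem_hatQ hinf x z α₁ T ω
  refine (norm_comp_one_sub_sq_le A G Q (hatQ x z α₁ T ω) (isStarProjection_eigProj hS _)).trans ?_
  gcongr
  exact norm_sub_comp_eigProj_truncLevel_le hS hα₂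

end Estimator

theorem enorm_le_ofReal {E : Type*} [SeminormedAddCommGroup E] {a : E} {c : ℝ} (h : ‖a‖ ≤ c) :
    ‖a‖ₑ ≤ ENNReal.ofReal c := by
  rw [← ofReal_norm]
  exact ENNReal.ofReal_le_ofReal h

section Consistency

variable {Ω : Type*} [MeasurableSpace Ω] {P : Measure Ω} {H : Type*} [NormedAddCommGroup H]
  [InnerProductSpace ℝ H] [CompleteSpace H] {A B : H →L[ℝ] H} {y x z u v : ℕ → Ω → H}
  {α₁ α₂ r : ℕ → ℝ}

theorem popQ_eq [IsProbabilityMeasure P] (hinf : ¬ FiniteDimensional ℝ H) (hx : MemLp (x 1) 2 P)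
    (hz : MemLp (z 1) 2 P) (hxz : x 1 =ᵐ[P] fun ω => B (z 1 ω) + v 1 ω)
    (hzv : momentOp P (z 1) (v 1) = 0) : popQ P x z = B ∘L popCzz P z ∘L B† := by
  have hv : MemLp (v 1) 2 P := (hx.sub (B.comp_memLp' hz)).ae_eq <| by
    filter_upwards [hxz] with ω hω
    simp [hω]
  have hvz : momentOp P (v 1) (z 1) = 0 := by
    rw [← adjoint_momentOp hz hv, hzv, map_zero]
  have hmoment : momentOp P (x 1) (z 1) = popCzz P z ∘L B† := by
    have hcongr : momentOp P (x 1) (z 1) = momentOp P (fun ω => B (z 1 ω) + v 1 ω) (z 1) :=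
      integral_congr_ae (hxz.mono fun ω hω => by simp only [hω])
    rw [hcongr, momentOp_map_add_left B hz hv hz, hvz, add_zero, popCzz]
  rw [popQ, hmoment]
  exact sandwichInv_comp_adjoint (isEigenSystem_eigval_eigvec hinf _
    (isCompactOperator_momentOp hz hz) (isPositive_momentOp_self hz)) B

theorem isLittleOpOne_hatQ_sub (hinf : ¬ FiniteDimensional ℝ H) (D : H →L[ℝ] H)
    (hx : ∀ᵐ ω ∂P, ∀ t, 1 ≤ t → x t ω = B (z t ω) + v t ω)
    (hzz : IsLittleOpOne P fun T ω => ‖sampleOp z z T ω - D‖ₑ)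
    (hvz : IsBigOp P (fun T ω => ‖sampleOp v z T ω‖ₑ) r) (hα₁ : ∀ T, 0 < α₁ T)
    (hα₁_lim : Tendsto α₁ atTop (𝓝 0))
    (hr : Tendsto (fun T => r T ^ 2 * (√(α₁ T))⁻¹) atTop (𝓝 0)) :
    IsLittleOpOne P fun T ω => ‖hatQ x z α₁ T ω - B ∘L D ∘L B†‖ₑ := by
  have hsqrt : Tendsto (fun T => √(α₁ T)) atTop (𝓝 0) := by simpa using hα₁_lim.sqrt
  have hr_sq : Tendsto (fun T => r T ^ 2 * 1) atTop (𝓝 0) := by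
    simpa [mul_assoc, (Real.sqrt_pos.mpr (hα₁ _)).ne'] using hr.mul hsqrt
  have hvz_op : IsLittleOpOne P fun T ω => ‖sampleOp v z T ω‖ₑ := by
    have hsq := (hvz.sq_mul_ofReal fun _ => 1).isLittleOpOne hr_sq
    simp only [ENNReal.ofReal_one, mul_one] at hsq
    exact hsq.of_sq
  have hvz_sq := (hvz.sq_mul_ofReal fun T => (√(α₁ T))⁻¹).isLittleOpOne hr
  have hproj := hzz.add ((isBigOp_ofReal P fun T => √(α₁ T)).isLittleOpOne hsqrt)
  refine (((hproj.const_mul (ENNReal.ofReal_ne_top (r := ‖B‖ ^ 2))).add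
    (hvz_op.const_mul (ENNReal.ofReal_ne_top (r := 2 * ‖B‖)))).add hvz_sq).mono fun T => ?_
  filter_upwards [hx] with ω hω
  refine (enorm_le_ofReal (norm_hatQ_sub_le hinf D (hα₁ T) hω)).trans_eq ?_
  simp (disch := positivity) only [ENNReal.ofReal_add, ENNReal.ofReal_mul, ENNReal.ofReal_pow,
    ofReal_norm]

theorem isLittleOpOne_comp_id_sub_tildeProj_sq {Q : H →L[ℝ] H} (hinf : ¬ FiniteDimensional ℝ H)
    (hA : IsCompactOperator A) (hker : Q.ker = ⊥)
    (hQ : IsLittleOpOne P fun T ω => ‖hatQ x z α₁ T ω - Q‖ₑ) (hα₂ : ∀ T, 0 < α₂ T)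
    (hα₂_lim : Tendsto α₂ atTop (𝓝 0)) :
    IsLittleOpOne P fun T ω => ‖A ∘L (.id ℝ H - tildeProj x z α₁ α₂ T ω)‖ₑ ^ 2 := by
  have hAA := isEigenSystem_eigval_eigvec hinf _ (hA.clm_comp (A†))
    (ContinuousLinearMap.isPositive_adjoint_comp_self A)
  refine isLittleOpOne_of_forall_le_add fun δ hδ => ?_
  obtain ⟨ε, hε, hεδ⟩ := ENNReal.lt_iff_exists_nnreal_btwn.mp hδ
  obtain ⟨G, hG⟩ := hAA.exists_norm_sub_comp_lt hker (NNReal.coe_pos.mpr (ENNReal.coe_pos.mp hε))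
  have hsqrt : Tendsto (fun T => √(α₂ T)) atTop (𝓝 0) := by simpa using hα₂_lim.sqrt
  refine ⟨_, (hQ.add ((isBigOp_ofReal P fun T => √(α₂ T)).isLittleOpOne hsqrt)).const_mul
    (ENNReal.ofReal_ne_top (r := ‖G‖)), fun T ω => ?_⟩
  rw [← enorm_norm, ← enorm_pow]
  calc ‖‖A ∘L (.id ℝ H - tildeProj x z α₁ α₂ T ω)‖ ^ 2‖ₑ
      ≤ ENNReal.ofReal (ε + ‖G‖ * (‖hatQ x z α₁ T ω - Q‖ + √(α₂ T))) := by
        refine enorm_le_ofReal ?_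
        rw [norm_pow, norm_norm]
        exact (norm_comp_id_sub_tildeProj_sq_le hinf A G Q (hα₂ T)).trans (by gcongr)
    _ = ε + ENNReal.ofReal ‖G‖ * (‖hatQ x z α₁ T ω - Q‖ₑ + ENNReal.ofReal √(α₂ T)) := by
        simp (disch := positivity) only [ENNReal.ofReal_add, ENNReal.ofReal_mul, ofReal_norm,
          ENNReal.ofReal_coe_nnreal]
    _ ≤ _ := by gcongr

theorem isBigOp_f2slse_sub_sq (hinf : ¬ FiniteDimensional ℝ H)
    (hy : ∀ᵐ ω ∂P, ∀ t, 1 ≤ t → y t ω = A (x t ω) + u t ω)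
    (huz : IsBigOp P (fun T ω => ‖sampleOp u z T ω‖ₑ) r) (hα₁ : ∀ T, 0 < α₁ T)
    (hα₂ : ∀ T, 0 < α₂ T) :
    IsBigOp P (fun T ω => ‖f2slse y x z α₁ α₂ T ω - A ∘L tildeProj x z α₁ α₂ T ω‖ₑ ^ 2)
      fun T => r T ^ 2 * (√(α₁ T))⁻¹ * (√(α₂ T))⁻¹ := by
  simp only [mul_assoc]
  refine (huz.sq_mul_ofReal fun T => (√(α₁ T))⁻¹ * (√(α₂ T))⁻¹).mono fun T => ?_
  filter_upwards [hy] with ω hω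
  rw [f2slse_sub_eq hinf (hα₂ T) hω, ← ofReal_norm, ← ofReal_norm,
    ← ENNReal.ofReal_pow (norm_nonneg _), ← ENNReal.ofReal_pow (norm_nonneg _),
    ← ENNReal.ofReal_mul (by positivity)]
  exact ENNReal.ofReal_le_ofReal (norm_f2slse_sq_le hinf (hα₁ T) (hα₂ T))

theorem isLittleOpOne_f2slse_sub
    (hnoise : IsLittleOpOne P fun T ω =>
      ‖f2slse y x z α₁ α₂ T ω - A ∘L tildeProj x z α₁ α₂ T ω‖ₑ ^ 2)
    (hbias : IsLittleOpOne P fun T ω => ‖A ∘L (.id ℝ H - tildeProj x z α₁ α₂ T ω)‖ₑ ^ 2) :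
    IsLittleOpOne P fun T ω => ‖f2slse y x z α₁ α₂ T ω - A‖ₑ := by
  refine (hnoise.of_sq.add hbias.of_sq).mono fun T => .of_forall fun ω => ?_
  have hsplit : f2slse y x z α₁ α₂ T ω - A =
      f2slse y x z α₁ α₂ T ω - A ∘L tildeProj x z α₁ α₂ T ω -
        A ∘L (.id ℝ H - tildeProj x z α₁ α₂ T ω) := by
    rw [ContinuousLinearMap.comp_sub, ContinuousLinearMap.comp_id]
    abel
  rw [hsplit]
  exact enorm_sub_le

end Consistency

section Model

variable {Ω : Type*} [MeasurableSpace Ω] {H : Type*} [NormedAddCommGroup H]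
  [InnerProductSpace ℝ H] [CompleteSpace H] [MeasurableSpace H] {P : Measure Ω} {A B : H →L[ℝ] H}
  {y x z u v : ℕ → Ω → H}

theorem Assumptions.momentOp_uz_eq_zero [SecondCountableTopology H] [BorelSpace H]
    [IsFiniteMeasure P] (h : Assumptions P A B y x z u v) : momentOp P (u 1) (z 1) = 0 := by
  have hle : pastSigma z u 1 ≤ ‹MeasurableSpace Ω› :=
    sup_le (iSup₂_le fun s hs => (h.measurable_z s hs.1).comap_le)
      (iSup₂_le fun s hs => (h.measurable_u s hs.1).comap_le)
  have hcomap : MeasurableSpace.comap (z 1) inferInstance ≤ pastSigma z u 1 :=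
    le_sup_of_le_left (le_iSup₂_of_le 1 (by simp) le_rfl)
  exact momentOp_eq_zero_of_condExp hle (h.sq_integrable_u 1 le_rfl) (h.sq_integrable_z 1 le_rfl)
    (Measurable.of_comap_le hcomap).stronglyMeasurable (h.mart_diff 1 le_rfl)

theorem Assumptions.isBigOp_sampleOp_uz [SecondCountableTopology H] [BorelSpace H]
    [IsFiniteMeasure P] (h : Assumptions P A B y x z u v) :
    IsBigOp P (fun T ω => ‖sampleOp u z T ω‖ₑ) fun T => (√(T : ℝ))⁻¹ :=
  h.rate_uz.mono fun T => .of_forall fun ω => by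
    simpa only [h.momentOp_uz_eq_zero, sub_zero] using enorm_le_hsNorm (sampleOp u z T ω)

theorem Assumptions.isBigOp_sampleOp_vz (h : Assumptions P A B y x z u v) :
    IsBigOp P (fun T ω => ‖sampleOp v z T ω‖ₑ) fun T => (√(T : ℝ))⁻¹ :=
  h.rate_vz.mono fun _ => .of_forall fun _ => enorm_le_hsNorm _

theorem Assumptions.isLittleOpOne_sampleOp_zz_sub (h : Assumptions P A B y x z u v) :
    IsLittleOpOne P fun T ω => ‖sampleOp z z T ω - popCzz P z‖ₑ :=
  (h.rate_zz.isLittleOpOne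
    (tendsto_inv_atTop_zero.comp (Real.tendsto_sqrt_atTop.comp tendsto_natCast_atTop_atTop))).mono
      fun _ => .of_forall fun _ => enorm_le_hsNorm _

end Model

theorem tendsto_mul_inv_sqrt_mul_inv_sqrt {ι : Type*} {l : Filter ι} {s α β : ι → ℝ}
    (hα : ∀ i, 0 < α i) (hs : Tendsto (fun i => s i * (α i)⁻¹) l (𝓝 0))
    (hαβ : Tendsto (fun i => α i / β i) l (𝓝 0)) :
    Tendsto (fun i => s i * (√(α i))⁻¹ * (√(β i))⁻¹) l (𝓝 0) := by
  have hlim := hs.mul hαβ.sqrt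
  rw [Real.sqrt_zero, mul_zero] at hlim
  refine hlim.congr fun i => ?_
  have hpos := Real.sqrt_pos.mpr (hα i)
  calc s i * (α i)⁻¹ * √(α i / β i) = s i * (√(α i) * √(α i))⁻¹ * (√(α i) / √(β i)) := by
        rw [Real.sqrt_div (hα i).le, Real.mul_self_sqrt (hα i).le]
    _ = s i * (√(α i))⁻¹ * (√(β i))⁻¹ := by field_simp

end F2SLS

theorem theorem5_general {Ω : Type*} [MeasurableSpace Ω] {H : Type*} [NormedAddCommGroup H]
    [InnerProductSpace ℝ H] [CompleteSpace H] (hinf : ¬ FiniteDimensional ℝ H) (P : Measure Ω)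
    [IsProbabilityMeasure P] (A B : H →L[ℝ] H) (y x z u v : ℕ → Ω → H)
    (model : ∀ t, 1 ≤ t → ∀ᵐ ω ∂P, y t ω = A (x t ω) + u t ω)
    (first_stage : ∀ t, 1 ≤ t → ∀ᵐ ω ∂P, x t ω = B (z t ω) + v t ω)
    (hx : MemLp (x 1) 2 P) (hz : MemLp (z 1) 2 P) (hzv : F2SLS.momentOp P (z 1) (v 1) = 0)
    (hker : (F2SLS.popQ P x z).ker = ⊥) (hA : IsCompactOperator A) (r : ℕ → ℝ)
    (hzz : F2SLS.IsLittleOpOne P fun T ω => ‖F2SLS.sampleOp z z T ω - F2SLS.popCzz P z‖ₑ)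
    (huz : F2SLS.IsBigOp P (fun T ω => ‖F2SLS.sampleOp u z T ω‖ₑ) r)
    (hvz : F2SLS.IsBigOp P (fun T ω => ‖F2SLS.sampleOp v z T ω‖ₑ) r)
    (α₁ α₂ : ℕ → ℝ) (hα₁ : ∀ T, 0 < α₁ T) (hα₂ : ∀ T, 0 < α₂ T)
    (hα₁_lim : Tendsto α₁ atTop (𝓝 0)) (hα₂_lim : Tendsto α₂ atTop (𝓝 0))
    (hr : Tendsto (fun T => r T ^ 2 * (√(α₁ T))⁻¹ * (√(α₂ T))⁻¹) atTop (𝓝 0)) :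
    F2SLS.IsBigOp P (fun T ω => ‖F2SLS.f2slse y x z α₁ α₂ T ω -
        A ∘L F2SLS.tildeProj x z α₁ α₂ T ω‖ₑ ^ 2)
      (fun T => r T ^ 2 * (√(α₁ T))⁻¹ * (√(α₂ T))⁻¹) ∧
    F2SLS.IsLittleOpOne P (fun T ω =>
      ‖A ∘L (ContinuousLinearMap.id ℝ H - F2SLS.tildeProj x z α₁ α₂ T ω)‖ₑ ^ 2) ∧
    F2SLS.IsLittleOpOne P (fun T ω => ‖F2SLS.f2slse y x z α₁ α₂ T ω - A‖ₑ) := by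
  have hy_all := ae_all_iff.mpr fun t => ae_all_iff.mpr (model t)
  have hx_all := ae_all_iff.mpr fun t => ae_all_iff.mpr (first_stage t)
  have hr₁ : Tendsto (fun T => r T ^ 2 * (√(α₁ T))⁻¹) atTop (𝓝 0) := by
    simpa [mul_assoc, (Real.sqrt_pos.mpr (hα₂ _)).ne'] using hr.mul hα₂_lim.sqrt
  have hQ : F2SLS.IsLittleOpOne P fun T ω => ‖F2SLS.hatQ x z α₁ T ω - F2SLS.popQ P x z‖ₑ := by
    rw [F2SLS.popQ_eq hinf hx hz (first_stage 1 le_rfl) hzv]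
    exact F2SLS.isLittleOpOne_hatQ_sub hinf _ hx_all hzz hvz hα₁ hα₁_lim hr₁
  have hnoise := F2SLS.isBigOp_f2slse_sub_sq hinf hy_all huz hα₁ hα₂
  have hbias := F2SLS.isLittleOpOne_comp_id_sub_tildeProj_sq hinf hA hker hQ hα₂ hα₂_lim
  exact ⟨hnoise, hbias, F2SLS.isLittleOpOne_f2slse_sub (hnoise.isLittleOpOne hr) hbias⟩

theorem theorem5 {Ω : Type*} [MeasurableSpace Ω] {H : Type*} [NormedAddCommGroup H]
    [InnerProductSpace ℝ H] [CompleteSpace H] [SecondCountableTopology H] [MeasurableSpace H]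
    [BorelSpace H] (hinf : ¬ FiniteDimensional ℝ H) (P : Measure Ω) [IsProbabilityMeasure P]
    (A B : H →L[ℝ] H) (y x z u v : ℕ → Ω → H) (hmodel : F2SLS.Assumptions P A B y x z u v)
    (α₁ α₂ : ℕ → ℝ) (hα₁ : ∀ T, 0 < α₁ T) (hα₂ : ∀ T, 0 < α₂ T)
    (hα₁_lim : Tendsto α₁ atTop (𝓝 0)) (hα₂_lim : Tendsto α₂ atTop (𝓝 0))
    (hα_ratio : Tendsto (fun T => α₁ T / α₂ T) atTop (𝓝 0))
    (hα₁_T : Tendsto (fun T : ℕ => (T : ℝ)⁻¹ * (α₁ T)⁻¹) atTop (𝓝 0))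
    (hgap : F2SLS.IsLittleOpOne P fun T ω => ‖(√(T : ℝ))⁻¹ *
      (∑ j ∈ Finset.range (F2SLS.K₁ z α₁ T ω), F2SLS.eigval (F2SLS.popCzz P z) j *
        F2SLS.gapConst (F2SLS.eigval (F2SLS.popCzz P z)) j) *
      (∑ j ∈ Finset.range (F2SLS.K₂ x z α₁ α₂ T ω),
        F2SLS.gapConst (F2SLS.eigval (F2SLS.popQ P x z)) j)‖ₑ)
    (htail : F2SLS.IsLittleOpOne P fun T ω =>
      ‖(∑' j, F2SLS.eigval (F2SLS.popCzz P z) (F2SLS.K₁ z α₁ T ω + j)) *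
      (∑ j ∈ Finset.range (F2SLS.K₂ x z α₁ α₂ T ω),
        F2SLS.gapConst (F2SLS.eigval (F2SLS.popQ P x z)) j)‖ₑ) :
    F2SLS.IsBigOp P (fun T ω => ‖F2SLS.f2slse y x z α₁ α₂ T ω -
        A ∘L F2SLS.tildeProj x z α₁ α₂ T ω‖ₑ ^ 2)
      (fun T => (T : ℝ)⁻¹ * (√(α₁ T))⁻¹ * (√(α₂ T))⁻¹) ∧
    F2SLS.IsLittleOpOne P (fun T ω =>
      ‖A ∘L (ContinuousLinearMap.id ℝ H - F2SLS.tildeProj x z α₁ α₂ T ω)‖ₑ ^ 2) ∧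
    F2SLS.IsLittleOpOne P (fun T ω => ‖F2SLS.f2slse y x z α₁ α₂ T ω - A‖ₑ) := by
  have hrate : ∀ T : ℕ, ((√(T : ℝ))⁻¹) ^ 2 = (T : ℝ)⁻¹ := fun T => by
    rw [inv_pow, Real.sq_sqrt T.cast_nonneg]
  have hnoise := F2SLS.tendsto_mul_inv_sqrt_mul_inv_sqrt hα₁ hα₁_T hα_ratio
  simpa only [hrate] using theorem5_general hinf P A B y x z u v hmodel.model hmodel.first_stage
    (hmodel.sq_integrable_x 1 le_rfl) (hmodel.sq_integrable_z 1 le_rfl)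
    (hmodel.first_stage_orth 1 le_rfl) hmodel.ker_Q
    (F2SLS.isCompactOperator_of_hsNorm_lt_top hmodel.hilbertSchmidt) (fun T => (√(T : ℝ))⁻¹)
    hmodel.isLittleOpOne_sampleOp_zz_sub hmodel.isBigOp_sampleOp_uz hmodel.isBigOp_sampleOp_vz
    α₁ α₂ hα₁ hα₂ hα₁_lim hα₂_lim (by simpa only [hrate] using hnoise)
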